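/- Let $G$ be a (discrete) group. Let $\operatorname{lcm}(G)$ be the least common multiple of the orders of the finite subgroups of $G$ ($+\infty$ if these orders are unbounded), and assume $\operatorname{lcm}(G)<\infty$. Let $K\subset\mathbb{C}$ be a subring whose field of fractions $F\subset\mathbb{C}$ is closed under complex conjugation. Let $\mathcal{N}(G)$ be the group von Neumann algebra (the weak closure of $\mathbb{C}[G]$ in $\mathcal{B}(\ell^2(G))$), $\mathcal{Z}(\mathcal{N}(G))$ its center, $\operatorname{tr}_G(a)=\langle a\delta_e,\delta_e\rangle$ the canonical trace, and $\operatorname{tr}^u:\mathcal{N}(G)\to\mathcal{Z}(\mathcal{N}(G))$ the center-valued trace, i.e. the unique $\mathbb{C}$-linear map with $\operatorname{tr}^u(ab)=\operatorname{tr}^u(ba)$, $\operatorname{tr}^u(c)=c$ for central $c$, and $\operatorname{tr}^u(a)\ge 0$ for $a\ge 0$; explicitly, $\operatorname{tr}^u(a)\delta_e$ is the orthogonal projection of $a\delta_e$ to the functions in $\ell^2(G)$ that are constant on conjugacy classes. Let $L_K(G)$ be the additive subgroup of $\mathcal{Z}(\mathcal{N}(G))$ generated by the elements $\operatorname{tr}^u(P)$,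 where $P=P^2=P^*$ runs through the projections in $F[H]$ and $H$ runs through the finite subgroups of $G$. Let $\Delta^+$ be the maximal finite normal subgroup of $G$, and let $\{P^i\}$ be the set of primitive (i.e. minimal nonzero) projections of the commutative algebra $\mathcal{Z}(\mathcal{N}(G))\cap\mathbb{C}[\Delta^+]$. Then: 1. $L_K(G)$ is discrete, both in the weak operator topology and in the norm topology. 2. The set $\{P^i\}$ is finite, its elements are pairwise orthogonal, and $L_K(G)$ is contained in the additive group generated by the elements $\bigl(\operatorname{lcm}(G)\cdot\operatorname{tr}_G(P^i)\bigr)^{-1}P^i$; that is, every element of $L_K(G)$ is a sum of integer multiples of these elements. (Here $\operatorname{tr}_G(P^i)=\dim_{\mathbb{C}}(P^i\,\mathbb{C}[\Delta^+])/|\Delta^+|$.) 3. In particular, if $G$ satisfies the center-valued Atiyah conjecture over $K$, i.e. if $\dim^u(\ker A)=\operatorname{tr}^u(\mathrm{pr}_{\ker A})\in L_K(G)$ for every $n$ and every $A\in \mathrm{Mat}_n(K[G])$ acting on $\ell^2(G)^n$ (with $\operatorname{tr}^u$ of a matrix over $\mathcal{N}(G)$ the sum of the center-valued traces of its diagonal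 entries), then the set of all these values $\dim^u(\ker A)$ is discrete. -/

import Mathlib

open scoped InnerProductSpace

noncomputable section

namespace GroupVN

/-- The Hilbert space `ℓ²(G)`. -/
abbrev L2 (G : Type*) : Type _ := lp (fun _ : G => ℂ) 2

section Permutation

variable {X : Type*}

lemma memlp_perm (σ : Equiv.Perm X) (f : L2 X) : Memℓp (fun x => f (σ.symm x)) 2 := by
  have h := f.2
  have h2 : (0 : ℝ) < (2 : ENNReal).toReal := by norm_num
  have h3 : Memℓp (f : X → ℂ) 2 := f.2
  rw [memℓp_gen_iff h2] at h3 ⊢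
  exact (σ.symm.summable_iff (f := fun x => ‖f x‖ ^ (2 : ENNReal).toReal)).2 h3

/-- The unitary operator `f ↦ f ∘ σ⁻¹` of `ℓ²(X)` induced by a permutation `σ` of `X`;
it maps `δ_x` to `δ_{σ x}`. -/
def permIsometry (σ : Equiv.Perm X) : L2 X →ₗᵢ[ℂ] L2 X where
  toFun f := ⟨fun x => f (σ.symm x), memlp_perm σ f⟩
  map_add' _ _ := rfl
  map_smul' _ _ := rfl
  norm_map' f := by
    have h2 : (0 : ℝ) < (2 : ENNReal).toReal := by norm_num
    rw [lp.norm_eq_tsum_rpow h2, lp.norm_eq_tsum_rpow h2]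
    congr 1
    exact σ.symm.tsum_eq (fun x => ‖f x‖ ^ (2 : ENNReal).toReal)

@[simp] lemma permIsometry_apply (σ : Equiv.Perm X) (f : L2 X) (x : X) :
    permIsometry σ f x = f (σ.symm x) := rfl

end Permutation

variable (G : Type*) [Group G]

/-- Bounded operators on `ℓ²(G)`, with the weak operator topology. -/
abbrev Op : Type _ := L2 G →WOT[ℂ] L2 G

/-- The left regular representation, `(λ_g f)(x) = f(g⁻¹x)`. -/
def leftRegular : G →* Op G where
  toFun g := .ofCLM (permIsometry (Equiv.mulLeft g)).toContinuousLinearMap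
  map_one' := ContinuousLinearMapWOT.ext fun f => by ext x; simp; rfl
  map_mul' g h := ContinuousLinearMapWOT.ext fun f => by
    ext x
    exact congrArg f (show (g * h)⁻¹ * x = h⁻¹ * (g⁻¹ * x) by group)

/-- The action of the group ring `ℂ[G]` on `ℓ²(G)` by left convolution. -/
def groupRingRep : MonoidAlgebra ℂ G →ₐ[ℂ] Op G := MonoidAlgebra.lift ℂ (Op G) G (leftRegular G)

/-- `δ_e ∈ ℓ²(G)`. -/
def deltaOne : L2 G := by classical exact lp.single 2 (1 : G) (1 : ℂ)

variable {G}

lemma leftRegular_apply (g : G) (f : L2 G) (x : G) : leftRegular G g f x = f (g⁻¹ * x) := rfl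

lemma inner_perm {X : Type*} (σ : Equiv.Perm X) (f h : L2 X) :
    ⟪permIsometry σ f, h⟫_ℂ = ⟪f, permIsometry σ⁻¹ h⟫_ℂ := by
  have : permIsometry σ (permIsometry σ⁻¹ h) = h := by
    ext x
    simp [Equiv.Perm.inv_def]
  conv_lhs => rw [← this]
  exact (permIsometry σ).inner_map_map _ _

lemma star_leftRegular (g : G) : star (leftRegular G g) = leftRegular G g⁻¹ := by
  refine ContinuousLinearMapWOT.ext_inner fun x y => ?_
  rw [ContinuousLinearMapWOT.star_apply, ContinuousLinearMap.star_eq_adjoint,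
    ContinuousLinearMap.adjoint_inner_right]
  exact (inner_perm (Equiv.mulLeft g) y x).trans
    (by congr 1; ext z; simp [leftRegular_apply])

variable (G)

/-- The image of `ℂ[G]` in the bounded operators on `ℓ²(G)`, as a `*`-subalgebra. -/
def groupRingOp : StarSubalgebra ℂ (Op G) where
  toSubalgebra := (groupRingRep G).range
  star_mem' := by
    rintro _ ⟨a, rfl⟩
    show star (groupRingRep G a) ∈ (groupRingRep G).range
    induction a using MonoidAlgebra.induction_on with
    | of g =>
      refine ⟨MonoidAlgebra.of ℂ G g⁻¹, ?_⟩
      simp [groupRingRep, star_leftRegular]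
    | add a b ha hb => simpa using add_mem ha hb
    | smul r a ha => simpa using Subalgebra.smul_mem _ ha _

/-- The group von Neumann algebra `N(G)`: the weak closure of `ℂ[G]` in the bounded operators
on `ℓ²(G)`. -/
def NG : StarSubalgebra ℂ (Op G) := (groupRingOp G).topologicalClosure

/-- The inclusion `ℂ[G] → N(G)`. -/
def groupRingToNG : MonoidAlgebra ℂ G →ₐ[ℂ] NG G :=
  (groupRingRep G).codRestrict (NG G).toSubalgebra
    fun a => (groupRingOp G).le_topologicalClosure ⟨a, rfl⟩

/-- The center `Z(N(G))`. -/
abbrev ZNG : Subalgebra ℂ (NG G) := Subalgebra.center ℂ (NG G)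

/-- The canonical trace `tr_G(a) = ⟨a δ_e, δ_e⟩` (Mathlib's inner product is linear in the second
variable, so this is the value of `a δ_e` at `e`). -/
def trG (a : NG G) : ℂ := ⟪deltaOne G, (a : Op G) (deltaOne G)⟫_ℂ

/-- The closed subspace of `ℓ²(G)` of functions that are constant on conjugacy classes. -/
def classFunctions : Submodule ℂ (L2 G) where
  carrier := {f | ∀ g x : G, f (g * x * g⁻¹) = f x}
  add_mem' := by intro a b ha hb g x; simp [ha g x, hb g x]
  zero_mem' := by intro g x; simp
  smul_mem' := by intro c a ha g x; simp [ha g x]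

lemma isClosed_classFunctions : IsClosed (classFunctions G : Set (L2 G)) := by
  have : (classFunctions G : Set (L2 G)) =
      ⋂ g : G, ⋂ x : G, {f : L2 G | lp.evalCLM ℂ (fun _ : G => ℂ) 2 (g * x * g⁻¹) f =
        lp.evalCLM ℂ (fun _ : G => ℂ) 2 x f} := by
    ext f; simp [classFunctions, lp.evalCLM]; rfl
  rw [this]
  exact isClosed_iInter fun g => isClosed_iInter fun x =>
    isClosed_eq (ContinuousLinearMap.continuous _) (ContinuousLinearMap.continuous _)

instance : CompleteSpace (classFunctions G) := (isClosed_classFunctions G).completeSpace_coe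


variable {G}

lemma deltaOne_apply (x : G) [Decidable (x = 1)] : deltaOne G x = if x = 1 then 1 else 0 := by
  classical
  rw [deltaOne, lp.single_apply]
  simp [Pi.single_apply]

/-- Right translation, as an auxiliary operator. -/
def rightTrans (h : G) : Op G := .ofCLM (permIsometry (Equiv.mulRight h)).toContinuousLinearMap

lemma rightTrans_apply (g : G) (f : L2 G) (x : G) : rightTrans g f x = f (x * g⁻¹) := rfl

lemma groupRing_comm_right (a : MonoidAlgebra ℂ G) (h : G) :
    groupRingRep G a * rightTrans h = rightTrans h * groupRingRep G a := by
  induction a using MonoidAlgebra.induction_on with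
  | of g =>
    refine ContinuousLinearMapWOT.ext fun f => ?_
    ext x
    simp only [groupRingRep, MonoidAlgebra.lift_of, ContinuousLinearMapWOT.mul_apply,
      leftRegular_apply, rightTrans_apply, mul_assoc]
  | add a b ha hb => rw [map_add, add_mul, mul_add, ha, hb]
  | smul r a ha =>
    refine ContinuousLinearMapWOT.ext fun f => ?_
    have h1 := congrArg (fun S : Op G => r • S f) ha
    simpa using h1

lemma NG_induction {p : Op G → Prop} (hp : IsClosed {T | p T})
    (h : ∀ a, p (groupRingRep G a)) (T : NG G) : p T := by
  have : closure (groupRingOp G : Set (Op G)) ⊆ {T | p T} :=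
    closure_minimal (by rintro _ ⟨a, rfl⟩; exact h a) hp
  exact this T.2

lemma NG_comm_right (T : NG G) (h : G) : (T : Op G) * rightTrans h = rightTrans h * T :=
  NG_induction (p := fun T => T * rightTrans h = rightTrans h * T)
    (isClosed_eq (continuous_mul_const _) (continuous_const_mul _))
    (fun a => groupRing_comm_right a h) T

lemma NG_right (T : NG G) (h : G) (f : L2 G) :
    (T : Op G) (rightTrans h f) = rightTrans h ((T : Op G) f) :=
  congrArg (fun S : Op G => S f) (NG_comm_right T h)

lemma single_eq [DecidableEq G] (h : G) : lp.single 2 h (1 : ℂ) = rightTrans h (deltaOne G) := by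
  ext x
  rw [rightTrans_apply, deltaOne_apply, lp.single_apply]
  simp [Pi.single_apply, mul_inv_eq_one]

/-- `δ_e` is separating for `N(G)`. -/
lemma NG_ext {S T : NG G} (h : (S : Op G) (deltaOne G) = (T : Op G) (deltaOne G)) : S = T := by
  classical
  refine Subtype.ext (ContinuousLinearMapWOT.toCLM_injective
    (lp.ext_continuousLinearMap (p := 2) (by norm_num) fun i => ?_))
  ext
  simp only [ContinuousLinearMap.comp_apply, lp.singleContinuousLinearMap_apply, single_eq]
  rw [ContinuousLinearMapWOT.toCLM_apply, ContinuousLinearMapWOT.toCLM_apply, NG_right, NG_right, h]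


open Filter Topology

/-- Vectors `T δ_e` with `T ∈ N(G)` of norm at most `C` (and positive if `q` holds). -/
def orbitSet (C : ℝ) (q : Prop) : Set (L2 G) :=
  {v | ∃ T : NG G, (T : Op G) (deltaOne G) = v ∧ ‖(T : Op G).toCLM‖ ≤ C ∧
    (q → (T : Op G).toCLM.IsPositive)}

lemma convex_orbitSet (C : ℝ) (q : Prop) : Convex ℝ (orbitSet C q : Set (L2 G)) := by
  rintro _ ⟨S, rfl, hS, hSp⟩ _ ⟨T, rfl, hT, hTp⟩ a b ha hb hab
  refine ⟨(a : ℂ) • S + (b : ℂ) • T, ?_, ?_, ?_⟩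
  · show (a : ℂ) • (S : Op G) (deltaOne G) + (b : ℂ) • (T : Op G) (deltaOne G) = _
    simp
    rfl
  · show ‖(a : ℂ) • (S : Op G).toCLM + (b : ℂ) • (T : Op G).toCLM‖ ≤ C
    refine (norm_add_le _ _).trans ?_
    rw [norm_smul, norm_smul, Complex.norm_of_nonneg ha, Complex.norm_of_nonneg hb]
    calc _ ≤ a * C + b * C := by gcongr
      _ = C := by rw [← add_mul, hab, one_mul]
  · intro h
    show ((a : ℂ) • (S : Op G).toCLM + (b : ℂ) • (T : Op G).toCLM).IsPositive
    refine .add (.smul_of_nonneg (hSp h) ?_) (.smul_of_nonneg (hTp h) ?_) <;>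
    simpa using by assumption

lemma isClosed_orbitSet (C : ℝ) (q : Prop) : IsClosed (orbitSet C q : Set (L2 G)) := by
  classical
  refine isClosed_of_closure_subset fun v hv => ?_
  obtain ⟨w, hw, hwv⟩ := mem_closure_iff_seq_limit.1 hv
  choose T hTw hTC hTp using hw
  have hC : 0 ≤ C := (norm_nonneg _).trans (hTC 0)
  have bound : ∀ n f, ‖(T n : Op G) f‖ ≤ C * ‖f‖ := fun n f =>
    (T n : Op G).toCLM.le_of_opNorm_le (hTC n) f
  let D : Submodule ℂ (L2 G) :=
    { carrier := {f | CauchySeq fun n => (T n : Op G) f}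
      add_mem' := fun {f g} hf hg => by
        simpa using! CauchySeq.add hf hg
      zero_mem' := by simpa using cauchySeq_const (0 : L2 G)
      smul_mem' := fun c f hf => by
        have : UniformContinuous fun f : L2 G => c • f := uniformContinuous_const_smul c
        simpa [Function.comp_def] using! this.comp_cauchySeq hf }
  have hDclosed : IsClosed (D : Set (L2 G)) := by
    refine isClosed_of_closure_subset fun f hf => ?_
    refine Metric.cauchySeq_iff.2 fun ε hε => ?_
    obtain ⟨g, hg, hfg⟩ := Metric.mem_closure_iff.1 hf (ε / (3 * (C + 1))) (by positivity)
    obtain ⟨N, hN⟩ := Metric.cauchySeq_iff.1 hg (ε / 3) (by positivity)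
    have key : ∀ n, dist ((T n : Op G) f) ((T n : Op G) g) ≤ ε / 3 := fun n => by
      rw [dist_eq_norm, ← map_sub]
      refine (bound n _).trans ?_
      rw [← dist_eq_norm]
      calc C * dist f g ≤ (C + 1) * (ε / (3 * (C + 1))) := by gcongr; linarith
        _ = ε / 3 := by field_simp
    refine ⟨N, fun m hm n hn => ?_⟩
    have h1 := key m
    have h2 := key n
    have h3 := hN m hm n hn
    have h4 := dist_triangle4 ((T m : Op G) f) ((T m : Op G) g) ((T n : Op G) g) ((T n : Op G) f)
    rw [dist_comm ((T n : Op G) g)] at h4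
    linarith
  have hDtop : ∀ f, f ∈ D := fun f => by
    have hs := lp.hasSum_single (p := 2) (by norm_num) f
    refine hDclosed.mem_of_tendsto hs (.of_forall fun s => D.sum_mem fun i _ => ?_)
    have : lp.single 2 i (f i) = f i • rightTrans i (deltaOne G) := by
      rw [← single_eq, ← lp.single_smul]; simp
    rw [this]
    refine D.smul_mem _ ?_
    show CauchySeq fun n => (T n : Op G) _
    simp only [NG_right, hTw]
    exact ((rightTrans i).toCLM.continuous.tendsto v |>.comp hwv).cauchySeq
  choose F hF using fun f => cauchySeq_tendsto_of_complete (hDtop f)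
  let L : L2 G →L[ℂ] L2 G :=
    continuousLinearMapOfTendsto (l := atTop) (fun n => (T n : Op G).toCLM) (f := F)
      (tendsto_pi_nhds.2 hF)
  have hL : ∀ f, Tendsto (fun n => (T n : Op G) f) atTop (𝓝 (L f)) := hF
  have hmem : (ContinuousLinearMapWOT.ofCLM L : Op G) ∈ NG G := by
    refine (groupRingOp G).isClosed_topologicalClosure.mem_of_tendsto
      (f := fun n => (T n : Op G)) (b := atTop) ?_ (.of_forall fun n => (T n).2)
    rw [ContinuousLinearMapWOT.tendsto_iff_forall_inner_apply_tendsto]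
    exact fun x y => tendsto_const_nhds.inner (hL x)
  refine ⟨⟨_, hmem⟩, ?_, ?_, ?_⟩
  · refine tendsto_nhds_unique (hL _) ?_
    simpa only [hTw] using hwv
  · exact L.opNorm_le_bound hC fun f =>
      le_of_tendsto (hL f).norm (.of_forall fun n => bound n f)
  · intro hq
    show L.IsPositive
    refine ⟨fun x y => ?_, fun x => ?_⟩
    · refine tendsto_nhds_unique ((hL x).inner (tendsto_const_nhds (x := y)))
        (((tendsto_const_nhds (x := x)).inner (hL y)).congr fun n => ?_)
      exact ((hTp n hq).inner_left_eq_inner_right x y).symm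
    · exact ge_of_tendsto ((Complex.continuous_re.tendsto _).comp ((hL x).inner tendsto_const_nhds))
        (.of_forall fun n => (hTp n hq).re_inner_nonneg_left x)


/-- Conjugation on `ℓ²(G)`: `(c_g f)(x) = f(g⁻¹xg)`. -/
def conjIsometry (g : G) : L2 G →ₗᵢ[ℂ] L2 G := permIsometry (MulAut.conj g).toEquiv

lemma conjIsometry_apply (g : G) (f : L2 G) (x : G) : conjIsometry g f x = f (g⁻¹ * x * g) := by
  simp [conjIsometry]

lemma mem_classFunctions (f : L2 G) : f ∈ classFunctions G ↔ ∀ g, conjIsometry g f = f := by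
  constructor
  · intro hf g
    ext x
    rw [conjIsometry_apply]
    simpa using hf g⁻¹ x
  · intro hf g x
    conv_rhs => rw [← hf g⁻¹, conjIsometry_apply]
    simp

lemma proj_conj (g : G) (f : L2 G) :
    (classFunctions G).starProjection (conjIsometry g f) = (classFunctions G).starProjection f := by
  rw [← sub_eq_zero, ← map_sub, Submodule.starProjection_apply_eq_zero_iff,
    Submodule.mem_orthogonal]
  intro u hu
  rw [inner_sub_right, sub_eq_zero]
  conv_lhs => rw [← (mem_classFunctions u).1 hu g]
  exact (conjIsometry g).inner_map_map _ _

lemma conj_mul (g h : G) (f : L2 G) :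
    conjIsometry g (conjIsometry h f) = conjIsometry (g * h) f := by
  ext x
  simp only [conjIsometry_apply]
  congr 1
  group

/-- The projection to class functions lies in every closed convex set containing
all conjugates. -/
lemma proj_mem {v : L2 G} {C : Set (L2 G)} (hC : IsClosed C) (hconv : Convex ℝ C)
    (hv : ∀ g, conjIsometry g v ∈ C) : (classFunctions G).starProjection v ∈ C := by
  set K : Set (L2 G) := closure (convexHull ℝ (Set.range fun g => conjIsometry g v)) with hK
  have hKconv : Convex ℝ K := (convex_convexHull ℝ _).closure
  have hKmin : ∀ D : Set (L2 G), IsClosed D → Convex ℝ D → (∀ g, conjIsometry g v ∈ D) → K ⊆ D :=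
    fun D h1 h2 h3 => closure_minimal (convexHull_min (by rintro _ ⟨g, rfl⟩; exact h3 g) h2) h1
  have hKsub : ∀ g, conjIsometry g v ∈ K := fun g =>
    subset_closure (subset_convexHull ℝ _ ⟨g, rfl⟩)
  have hKc : ∀ h, ∀ w ∈ K, conjIsometry h w ∈ K := fun h =>
    hKmin (conjIsometry h ⁻¹' K) (isClosed_closure.preimage (conjIsometry h).continuous)
      (hKconv.linear_preimage ((conjIsometry h).toLinearMap.restrictScalars ℝ))
      (fun g => by
        show conjIsometry h (conjIsometry g v) ∈ K
        rw [conj_mul]; exact hKsub _)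
  have hKP : ∀ w ∈ K, (classFunctions G).starProjection w = (classFunctions G).starProjection v :=
    hKmin {w | (classFunctions G).starProjection w = (classFunctions G).starProjection v}
      (isClosed_eq (ContinuousLinearMap.continuous _) continuous_const)
      ((convex_singleton ((classFunctions G).starProjection v)).linear_preimage
        ((classFunctions G).starProjection.toLinearMap.restrictScalars ℝ))
      (fun g => proj_conj g v)
  let _ : InnerProductSpace ℝ (L2 G) := InnerProductSpace.rclikeToReal ℂ (L2 G)
  obtain ⟨w, hw, hmin⟩ := exists_norm_eq_iInf_of_complete_convex (K := K) ⟨_, hKsub 1⟩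
    isClosed_closure.isComplete hKconv 0
  have hle : ∀ u ∈ K, ‖w‖ ≤ ‖u‖ := fun u hu => by
    have := ciInf_le (f := fun w : K => ‖(0 : L2 G) - w‖)
      ⟨0, by rintro _ ⟨x, rfl⟩; exact norm_nonneg _⟩ ⟨u, hu⟩
    rw [← hmin] at this
    simpa using this
  have hfix : w ∈ classFunctions G := by
    rw [mem_classFunctions]
    intro g
    have hmid := hle _ (hKconv (hKc g w hw) hw (a := 1 / 2) (b := 1 / 2)
      (by norm_num) (by norm_num) (by norm_num))
    rw [← smul_add, norm_smul] at hmid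
    have hpar := parallelogram_law_with_norm ℝ (conjIsometry g w) w
    rw [(conjIsometry g).norm_map] at hpar
    have h0 : ‖conjIsometry g w - w‖ = 0 := by
      norm_num at hmid
      nlinarith [norm_nonneg w, norm_nonneg (conjIsometry g w - w)]
    exact sub_eq_zero.1 (norm_eq_zero.1 h0)
  have : (classFunctions G).starProjection v = w := by
    rw [← hKP w hw, Submodule.starProjection_eq_self_iff.2 hfix]
  rw [this]
  exact hKmin C hC hconv hv hw

lemma leftRegular_mem (g : G) : leftRegular G g ∈ NG G :=
  (groupRingOp G).le_topologicalClosure ⟨MonoidAlgebra.of ℂ G g, by simp [groupRingRep]⟩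

lemma leftRegular_deltaOne (g : G) :
    leftRegular G g (deltaOne G) = rightTrans g (deltaOne G) := by
  classical
  ext x
  simp [leftRegular_apply, rightTrans_apply, deltaOne_apply, inv_mul_eq_one, mul_inv_eq_one,
    eq_comm]

lemma leftRegular_rightTrans (g : G) (f : L2 G) :
    leftRegular G g (rightTrans g⁻¹ f) = conjIsometry g f := by
  ext x
  simp [leftRegular_apply, rightTrans_apply, conjIsometry_apply]

lemma norm_leftRegular_le (g : G) : ‖(leftRegular G g).toCLM‖ ≤ 1 :=
  (permIsometry (Equiv.mulLeft g)).norm_toContinuousLinearMap_le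

lemma exists_centerValued (a : NG G) : ∃ T : NG G, T ∈ ZNG G ∧
    (T : Op G) (deltaOne G) = (classFunctions G).starProjection ((a : Op G) (deltaOne G)) ∧
    ((a : Op G).toCLM.IsPositive → (T : Op G).toCLM.IsPositive) := by
  obtain ⟨T, hT, -, hpos⟩ := proj_mem (v := (a : Op G) (deltaOne G))
    (isClosed_orbitSet ‖(a : Op G).toCLM‖ (a : Op G).toCLM.IsPositive) (convex_orbitSet _ _)
    (fun g => by
      refine ⟨⟨leftRegular G g, leftRegular_mem g⟩ * a * ⟨leftRegular G g⁻¹, leftRegular_mem _⟩,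
        ?_, ?_, fun hp => ?_⟩
      · show leftRegular G g ((a : Op G) (leftRegular G g⁻¹ (deltaOne G))) = _
        rw [leftRegular_deltaOne, NG_right, leftRegular_rightTrans]
      · show ‖(leftRegular G g).toCLM * (a : Op G).toCLM * (leftRegular G g⁻¹).toCLM‖ ≤ _
        refine (norm_mul_le _ _).trans ?_
        refine (mul_le_of_le_one_right (norm_nonneg _) (norm_leftRegular_le _)).trans ?_
        refine (norm_mul_le _ _).trans ?_
        exact mul_le_of_le_one_left (norm_nonneg _) (norm_leftRegular_le _)
      · have h1 := hp.conj_adjoint (leftRegular G g).toCLM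
        have h2 : ContinuousLinearMap.adjoint (leftRegular G g).toCLM
            = (leftRegular G g⁻¹).toCLM := by
          rw [← star_leftRegular]; rfl
        rw [h2] at h1
        exact h1)
  refine ⟨T, ?_, hT, hpos⟩
  have hcomm : ∀ g, leftRegular G g * (T : Op G) = T * leftRegular G g := by
    intro g
    have : (⟨leftRegular G g, leftRegular_mem g⟩ * T : NG G) =
        T * ⟨leftRegular G g, leftRegular_mem g⟩ := by
      refine NG_ext ?_
      show leftRegular G g ((T : Op G) (deltaOne G)) = (T : Op G) (leftRegular G g (deltaOne G))
      rw [leftRegular_deltaOne, NG_right, hT]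
      set ξ := (classFunctions G).starProjection ((a : Op G) (deltaOne G))
      have hξ : ξ ∈ classFunctions G := Submodule.starProjection_apply_mem _ _
      ext x
      rw [leftRegular_apply, rightTrans_apply]
      have := hξ g⁻¹ (x * g⁻¹)
      rw [← this]
      congr 1
      group
    exact congrArg Subtype.val this
  rw [Subalgebra.mem_center_iff]
  intro b
  refine Subtype.ext ?_
  refine NG_induction (p := fun S : Op G => S * (T : Op G) = (T : Op G) * S)
    (isClosed_eq (continuous_mul_const _) (continuous_const_mul _)) (fun c => ?_) b
  induction c using MonoidAlgebra.induction_on with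
  | of g => simpa [groupRingRep] using hcomm g
  | add a b ha hb => rw [map_add, add_mul, mul_add, ha, hb]
  | smul r a ha =>
    refine ContinuousLinearMapWOT.ext fun f => ?_
    have h1 := congrArg (fun S : Op G => r • S f) ha
    simpa using h1

variable (G)

/-- The center-valued trace `tr^u : N(G) → Z(N(G))`. It has the properties that characterize
the center-valued trace, see `isCenterValuedTrace_centerTrace` below. Concretely, `tr^u(a)` is the central element which
corresponds, under the standard embedding `b ↦ b δ_e` of `N(G)` into `ℓ²(G)`, to the orthogonal
projection of `a δ_e` to the functions that are constant on conjugacy classes. -/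
def centerTrace : NG G →ₗ[ℂ] ZNG G where
  toFun a := ⟨(exists_centerValued a).choose, (exists_centerValued a).choose_spec.1⟩
  map_add' a b := Subtype.ext <| NG_ext <| by
    have h := fun c : NG G => (exists_centerValued c).choose_spec.2.1
    show _ = ((exists_centerValued a).choose : Op G) (deltaOne G) +
      ((exists_centerValued b).choose : Op G) (deltaOne G)
    rw [h, h, h, ← map_add]
    rfl
  map_smul' c a := Subtype.ext <| NG_ext <| by
    have h := fun c : NG G => (exists_centerValued c).choose_spec.2.1
    show _ = c • ((exists_centerValued a).choose : Op G) (deltaOne G)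
    rw [h, h, ← map_smul]
    rfl

lemma centerTrace_deltaOne (a : NG G) : ((centerTrace G a : NG G) : Op G) (deltaOne G) =
    (classFunctions G).starProjection ((a : Op G) (deltaOne G)) :=
  (exists_centerValued a).choose_spec.2.1

lemma centerTrace_nonneg (a : NG G) (ha : (a : Op G).toCLM.IsPositive) :
    ((centerTrace G a : NG G) : Op G).toCLM.IsPositive :=
  (exists_centerValued a).choose_spec.2.2 ha

lemma central_mem_classFunctions (c : ZNG G) :
    ((c : NG G) : Op G) (deltaOne G) ∈ classFunctions G := by
  rw [mem_classFunctions]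
  intro g
  have h := (Subalgebra.mem_center_iff.1 c.2) ⟨leftRegular G g, leftRegular_mem g⟩
  have h2 := congrArg (fun S : NG G => (S : Op G) (rightTrans g⁻¹ (deltaOne G))) h
  change leftRegular G g (((c : NG G) : Op G) (rightTrans g⁻¹ (deltaOne G))) =
    ((c : NG G) : Op G) (leftRegular G g (rightTrans g⁻¹ (deltaOne G))) at h2
  rw [NG_right, leftRegular_rightTrans, leftRegular_rightTrans] at h2
  rw [h2]
  have : (deltaOne G) ∈ classFunctions G := by
    classical
    intro g x
    simp [deltaOne_apply]
  rw [(mem_classFunctions _).1 this g]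

lemma centerTrace_central (c : ZNG G) : centerTrace G c = c := by
  refine Subtype.ext (NG_ext ?_)
  rw [centerTrace_deltaOne,
    Submodule.starProjection_eq_self_iff.2 (central_mem_classFunctions G c)]


lemma proj_mul_comm (a b : NG G) :
    (classFunctions G).starProjection ((a : Op G) ((b : Op G) (deltaOne G))) =
    (classFunctions G).starProjection ((b : Op G) ((a : Op G) (deltaOne G))) := by
  rw [← sub_eq_zero, ← map_sub, Submodule.starProjection_apply_eq_zero_iff,
    Submodule.mem_orthogonal]
  intro ζ hζ
  rw [inner_sub_right, sub_eq_zero]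
  refine NG_induction (p := fun S : Op G =>
    ⟪ζ, S ((b : Op G) (deltaOne G))⟫_ℂ = ⟪ζ, (b : Op G) (S (deltaOne G))⟫_ℂ)
    (isClosed_eq ?_ ?_) (fun c => ?_) a
  · exact (ContinuousLinearMapWOT.continuous_iff.1 continuous_id) _ _
  · exact (ContinuousLinearMapWOT.continuous_iff.1
      (continuous_const_mul (b : Op G))) (deltaOne G) ζ
  · induction c using MonoidAlgebra.induction_on with
    | of g =>
      simp only [groupRingRep, MonoidAlgebra.lift_of]
      rw [leftRegular_deltaOne, NG_right]
      set w := (b : Op G) (deltaOne G)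
      have h1 : leftRegular G g w = conjIsometry g (rightTrans g w) := by
        rw [← leftRegular_rightTrans]
        congr 1
        ext x
        simp [rightTrans_apply]
      rw [h1]
      conv_lhs => rw [← (mem_classFunctions ζ).1 hζ g]
      exact (conjIsometry g).inner_map_map _ _
    | add a b ha hb => simp [ha, hb]
    | smul r a ha => simp [ha]

/-- The defining properties of the center-valued trace on `N(G)`. -/
structure IsCenterValuedTrace (τ : NG G →ₗ[ℂ] ZNG G) : Prop where
  mul_comm : ∀ a b : NG G, τ (a * b) = τ (b * a)
  central : ∀ c : ZNG G, τ c = c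
  nonneg : ∀ a : NG G, (a : Op G).toCLM.IsPositive → ((τ a : NG G) : Op G).toCLM.IsPositive

theorem isCenterValuedTrace_centerTrace : IsCenterValuedTrace G (centerTrace G) where
  mul_comm a b := Subtype.ext <| NG_ext <| by
    rw [centerTrace_deltaOne, centerTrace_deltaOne]
    exact proj_mul_comm G a b
  central := centerTrace_central G
  nonneg := centerTrace_nonneg G

section Matrices

variable {G} {n : ℕ}

/-- The Hilbert space `ℓ²(G)ⁿ`. -/
abbrev L2n (G : Type*) (n : ℕ) : Type _ := PiLp 2 (fun _ : Fin n => L2 G)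

/-- The `i`-th coordinate `ℓ²(G)ⁿ → ℓ²(G)`. -/
def coord (i : Fin n) : L2n G n →L[ℂ] L2 G := PiLp.proj 2 (fun _ : Fin n => L2 G) i

/-- The inclusion `ℓ²(G) → ℓ²(G)ⁿ` of the `i`-th summand. -/
def incl (i : Fin n) : L2 G →L[ℂ] L2n G n := ContinuousLinearMap.adjoint (coord i)

/-- The `(i, j)` matrix entry of an operator on `ℓ²(G)ⁿ`. -/
def entry (T : L2n G n →L[ℂ] L2n G n) (i j : Fin n) : Op G := .ofCLM (coord i ∘L T ∘L incl j)

/-- A matrix over `ℂ[G]` acting on `ℓ²(G)ⁿ` by left convolution. -/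
def matrixOp (A : Matrix (Fin n) (Fin n) (MonoidAlgebra ℂ G)) : L2n G n →L[ℂ] L2n G n :=
  ∑ i, ∑ j, incl i ∘L (groupRingRep G (A i j)).toCLM ∘L coord j

lemma incl_apply (j : Fin n) (v : L2 G) : incl j v = WithLp.toLp 2 (Pi.single j v) := by
  refine ext_inner_right ℂ fun y => ?_
  rw [incl, ContinuousLinearMap.adjoint_inner_left, PiLp.inner_apply,
    Finset.sum_eq_single j]
  · simp [coord]
  · intro b _ hb
    simp [Pi.single_eq_of_ne hb]
  · simp

lemma coord_incl (i j : Fin n) (v : L2 G) : coord i (incl j v) = if i = j then v else 0 := by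
  rw [incl_apply]
  simp [coord]

lemma sum_incl_coord (x : L2n G n) : ∑ i, incl i (coord i x) = x := by
  refine ext_inner_right ℂ fun y => ?_
  simp only [sum_inner, incl, ContinuousLinearMap.adjoint_inner_left, PiLp.inner_apply]
  rfl

lemma entry_apply (T : L2n G n →L[ℂ] L2n G n) (i j : Fin n) (v : L2 G) :
    entry T i j v = coord i (T (incl j v)) := rfl

/-- The operators on `ℓ²(G)ⁿ` all of whose matrix entries lie in `N(G)`. -/
def matNG (G : Type*) [Group G] (n : ℕ) : Subalgebra ℂ (L2n G n →L[ℂ] L2n G n) where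
  carrier := {T | ∀ i j, entry T i j ∈ NG G}
  add_mem' {S T} hS hT i j := by
    have : entry (S + T) i j = entry S i j + entry T i j :=
      ContinuousLinearMapWOT.ext fun v => by simp [entry_apply]
    rw [this]
    exact add_mem (hS i j) (hT i j)
  mul_mem' {S T} hS hT i j := by
    have : entry (S * T) i j = ∑ k, entry S i k * entry T k j :=
      ContinuousLinearMapWOT.toCLM_injective <| ContinuousLinearMap.ext fun v => by
        have h1 : (∑ k, entry S i k * entry T k j).toCLM =
            ∑ k, (entry S i k * entry T k j).toCLM :=
          map_sum (ContinuousLinearMapWOT.addEquiv (σ := RingHom.id ℂ) (E := L2 G) (F := L2 G)) _ _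
        rw [h1, sum_apply]
        show coord i (S (T (incl j v))) = ∑ k, coord i (S (incl k (coord k (T (incl j v)))))
        rw [← map_sum, ← map_sum, sum_incl_coord]
    rw [this]
    exact sum_mem fun k _ => mul_mem (hS i k) (hT k j)
  algebraMap_mem' c i j := by
    have : entry (algebraMap ℂ _ c : L2n G n →L[ℂ] L2n G n) i j =
        if i = j then algebraMap ℂ (Op G) c else 0 :=
      ContinuousLinearMapWOT.ext fun v => by
        rw [entry_apply, Algebra.algebraMap_eq_smul_one]
        simp only [smul_apply, one_apply_eq_self, map_smul,
          coord_incl]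
        split_ifs <;> simp
    rw [this]
    split_ifs
    · exact (NG G).algebraMap_mem c
    · exact zero_mem _

lemma matNG_adjoint {T : L2n G n →L[ℂ] L2n G n} (hT : T ∈ matNG G n) :
    ContinuousLinearMap.adjoint T ∈ matNG G n := fun i j => by
  have : entry (ContinuousLinearMap.adjoint T) i j = star (entry T j i) := by
    refine ContinuousLinearMapWOT.ext_inner fun x y => ?_
    rw [ContinuousLinearMapWOT.star_apply, ContinuousLinearMap.star_eq_adjoint,
      ContinuousLinearMap.adjoint_inner_right]
    calc ⟪y, coord i (ContinuousLinearMap.adjoint T (incl j x))⟫_ℂ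
        = ⟪T (incl i y), incl j x⟫_ℂ := by
          rw [← ContinuousLinearMap.adjoint_inner_left, ContinuousLinearMap.adjoint_inner_right]
          rfl
      _ = ⟪coord j (T (incl i y)), x⟫_ℂ := by
          rw [incl, incl, ContinuousLinearMap.adjoint_inner_right]
  rw [this]
  exact star_mem (hT j i)

lemma matrixOp_mem (A : Matrix (Fin n) (Fin n) (MonoidAlgebra ℂ G)) : matrixOp A ∈ matNG G n := by
  refine sum_mem fun k _ => sum_mem fun l _ => fun i j => ?_
  have : entry (incl k ∘L (groupRingRep G (A k l)).toCLM ∘L coord l) i j =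
      if i = k ∧ l = j then groupRingRep G (A k l) else 0 :=
    ContinuousLinearMapWOT.ext fun v => by
      rw [entry_apply]
      simp only [ContinuousLinearMap.comp_apply, coord_incl]
      split_ifs <;> simp_all
  rw [this]
  split_ifs
  · exact (groupRingToNG G (A k l)).2
  · exact zero_mem _

lemma matNG_of_tendsto {T : ℕ → L2n G n →L[ℂ] L2n G n} (hT : ∀ N, T N ∈ matNG G n)
    {P : L2n G n →L[ℂ] L2n G n} (h : ∀ x, Tendsto (fun N => T N x) atTop (𝓝 (P x))) :
    P ∈ matNG G n := fun i j => by
  refine (groupRingOp G).isClosed_topologicalClosure.mem_of_tendsto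
    (f := fun N => entry (T N) i j) (b := atTop) ?_ (.of_forall fun N => hT N i j)
  rw [ContinuousLinearMapWOT.tendsto_iff_forall_inner_apply_tendsto]
  intro x y
  exact tendsto_const_nhds.inner (((coord i).continuous.tendsto _).comp (h (incl j x)))

lemma starProjection_congr {E : Type*} [NormedAddCommGroup E] [InnerProductSpace ℂ E]
    {K K' : Submodule ℂ E} [K.HasOrthogonalProjection] [K'.HasOrthogonalProjection]
    (h : K = K') : K.starProjection = K'.starProjection := by
  subst h; rfl

/-- The projection onto the kernel of `T` is a strong limit of polynomials in `T* T`. -/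
lemma kerProj_limit {E : Type*} [NormedAddCommGroup E] [InnerProductSpace ℂ E] [CompleteSpace E]
    (T : E →L[ℂ] E) : ∃ t : ℂ, ∀ x, Tendsto (fun N : ℕ => (((N : ℂ)⁻¹) • ∑ k ∈ Finset.range N,
      (1 - t • (ContinuousLinearMap.adjoint T * T)) ^ k) x) atTop
      (𝓝 (T.ker.starProjection x)) := by
  obtain ⟨B, hB⟩ : ∃ B, B = ContinuousLinearMap.adjoint T * T := ⟨_, rfl⟩
  obtain ⟨t, ht⟩ : ∃ t : ℝ, t = (‖B‖ + 1)⁻¹ := ⟨_, rfl⟩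
  have htpos : 0 < t := by rw [ht]; positivity
  refine ⟨(t : ℂ), fun x => ?_⟩
  rw [← hB]
  obtain ⟨f, hf⟩ : ∃ f : E →L[ℂ] E, f = 1 - (t : ℂ) • B := ⟨_, rfl⟩
  have hBpos : 0 ≤ B := hB ▸ star_mul_self_nonneg T
  have htB : 0 ≤ (t : ℂ) • B := (ContinuousLinearMap.nonneg_iff_isPositive _).2
    (.smul_of_nonneg ((ContinuousLinearMap.nonneg_iff_isPositive _).1 hBpos)
      (by simpa using htpos.le))
  have hnorm : ‖(t : ℂ) • B‖ ≤ 1 := by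
    rw [norm_smul, Complex.norm_of_nonneg htpos.le, ht, inv_mul_le_iff₀ (by positivity)]
    linarith
  have hle : (t : ℂ) • B ≤ 1 := (CStarAlgebra.norm_le_one_iff_of_nonneg _ htB).1 hnorm
  have hf1 : ‖f‖ ≤ 1 := by
    rw [hf]
    exact (CStarAlgebra.norm_le_one_iff_of_nonneg _ (sub_nonneg.2 hle)).2 (sub_le_self _ htB)
  have hK : f.eqLocus (1 : E →L[ℂ] E) = T.ker := by
    ext x
    have h1 : x ∈ f.eqLocus (1 : E →L[ℂ] E) ↔ B x = 0 := by
      show f x = x ↔ _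
      simp [hf, htpos.ne']
    rw [h1, LinearMap.mem_ker]
    constructor
    · intro h
      have h2 : ⟪B x, x⟫_ℂ = 0 := by rw [h, inner_zero_left]
      rw [hB, mul_apply_eq_comp, ContinuousLinearMap.adjoint_inner_left,
        inner_self_eq_zero] at h2
      exact h2
    · intro h
      rw [hB, mul_apply_eq_comp]
      have h' : T x = 0 := h
      rw [h', map_zero]
  have h := f.tendsto_birkhoffAverage_orthogonalProjection hf1 x
  have h3 : ((f.eqLocus (1 : E →L[ℂ] E)).orthogonalProjectionOnto x : E) =
      T.ker.starProjection x := by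
    rw [← starProjection_congr hK]; rfl
  rw [h3] at h
  rw [← hf]
  refine h.congr fun N => ?_
  simp [birkhoffAverage, birkhoffSum]

lemma kerProj_mem {T : L2n G n →L[ℂ] L2n G n} (hT : T ∈ matNG G n) :
    T.ker.starProjection ∈ matNG G n := by
  obtain ⟨t, ht⟩ := kerProj_limit T
  exact matNG_of_tendsto (fun N => Subalgebra.smul_mem _ (sum_mem fun k _ => pow_mem
    (sub_mem (one_mem _) (Subalgebra.smul_mem _ (mul_mem (matNG_adjoint hT) hT) _)) k) _) ht

/-- The center-valued dimension `dim^u(ker A) = tr^u(pr_{ker A})`, where `tr^u` is extended to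
matrices over `N(G)` as the sum of the center-valued traces of the diagonal entries. -/
def kerDim (A : Matrix (Fin n) (Fin n) (MonoidAlgebra ℂ G)) : ZNG G :=
  ∑ i, centerTrace G ⟨entry (matrixOp A).ker.starProjection i i, kerProj_mem (matrixOp_mem A) i i⟩

end Matrices

/-! ### Finite subgroups -/

/-- `lcm(G)`: the least common multiple of the orders of the finite subgroups of `G`, which is
`⊤` if these orders are unbounded. -/
def lcmG : ℕ∞ :=
  ⨅ m ∈ {m : ℕ | 0 < m ∧ ∀ H : Subgroup G, Finite H → Nat.card H ∣ m}, (m : ℕ∞)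

/-- `Δ⁺(G)`: the maximal finite normal subgroup, i.e. the subgroup generated by all finite normal
subgroups (it is itself finite if `lcm(G) < ∞`). -/
def deltaPlus : Subgroup G := ⨆ N ∈ {N : Subgroup G | N.Normal ∧ Finite N}, N

variable {G}

/-- The elements of `R[H]` in `ℂ[G]`: the coefficients lie in `R`, the support lies in `H`. -/
def InGroupRing (R : Set ℂ) (H : Subgroup G) (a : MonoidAlgebra ℂ G) : Prop :=
  (∀ g, a.coeff g ∈ R) ∧ ∀ g, g ∉ H → a.coeff g = 0

variable (G)

/-- The field of fractions of a subring of `ℂ`, inside `ℂ`. -/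
abbrev fracField (K : Subring ℂ) : Subfield ℂ := Subfield.closure (K : Set ℂ)

/-- `L_K(G)`: the additive subgroup of `Z(N(G))` generated by the center-valued traces `tr^u(P)`
of the projections `P ∈ F[H]`, where `H` runs through the finite subgroups of `G`
and `F` is the field of fractions of `K`. -/
def LK (K : Subring ℂ) : AddSubgroup (ZNG G) :=
  AddSubgroup.closure {z | ∃ H : Subgroup G, Finite H ∧ ∃ P : MonoidAlgebra ℂ G,
    InGroupRing (fracField K : Set ℂ) H P ∧ IsStarProjection (groupRingToNG G P) ∧
    z = centerTrace G (groupRingToNG G P)}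

/-- The projections in the algebra `Z(N(G)) ∩ ℂ[Δ⁺(G)]`. -/
def centralProj : Set (ZNG G) :=
  {e | IsStarProjection (e : NG G) ∧
    ∃ a : MonoidAlgebra ℂ G, InGroupRing Set.univ (deltaPlus G) a ∧ groupRingToNG G a = e}

/-- The primitive (minimal nonzero) projections `P^i` of `Z(N(G)) ∩ ℂ[Δ⁺(G)]`. -/
def primitiveCentralProj : Set (ZNG G) :=
  {e | e ∈ centralProj G ∧ e ≠ 0 ∧ ∀ f ∈ centralProj G, e * f = f → f = 0 ∨ f = e}

/-- The center-valued Atiyah conjecture for `G` over `K`: `dim^u(ker A) ∈ L_K(G)` for all square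
matrices `A` over `K[G]`. -/
def CenterValuedAtiyah (K : Subring ℂ) : Prop :=
  ∀ (n : ℕ) (A : Matrix (Fin n) (Fin n) (MonoidAlgebra ℂ G)),
    (∀ i j g, (A i j).coeff g ∈ K) → kerDim A ∈ LK G K

end GroupVN
end

open GroupVN

/-! Applied to `δ_e`, the center-valued trace is the orthogonal projection onto class functions. An
`ℓ²` class function vanishes on every infinite conjugacy class, so a group element with infinite
class has trace zero. An element of a finite subgroup with finite class lies in a finite normal
subgroup by Dietzmann's lemma, hence in `Δ⁺`. So `tr^u` maps `ℂ[H]`, for `H` finite, into `Z(N(G)) ∩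
ℂ[Δ⁺]` (`centerTrace_mem`). This algebra is commutative, reduced and finite-dimensional over `ℂ`. It
is therefore spanned by its primitive idempotents `P^i`, which are orthogonal projections, and each
element `z` of it equals `∑ (tr_G(z P^i) / tr_G(P^i)) P^i` (`eq_sum_primitiveCentralProj`).

Integrality comes from `tr_G(tr^u(P) P^i) = tr_G(P P^i)` (`trG_centerTrace_mul`). Since `P^i` is
central, `P P^i` is an idempotent of `ℂ[HΔ⁺]`. The group order times the trace of an idempotent of a
finite group ring is a rank, and `|HΔ⁺|` divides `lcm(G)`. Hence `lcm(G) tr_G(z P^i)` is an integer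
for all `z` in `L_K(G)` (`trMul_integral`), which gives the containment.

Finitely many functionals `z ↦ lcm(G) tr_G(z P^i)`, continuous in both topologies, are thus
integer-valued on `L_K(G)` and separate its points, which forces discreteness. Under the Atiyah
conjecture the kernel dimensions form a subset of this discrete set. -/

namespace GroupVN

/-! ### Dietzmann's lemma: torsion elements with finite conjugacy class. -/

section FiniteNormal

variable {G : Type*} [Group G]

/-- The center is the intersection of the centralizers of the finitely many generators, and each of
these has finite index by orbit-stabilizer. -/
lemma finiteIndex_center_of_finite_generators {N : Type*} [Group N] {S : Set N} (hS : S.Finite)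
    (hgen : Subgroup.closure S = ⊤) (hconj : ∀ s ∈ S, (Set.range fun g => g * s * g⁻¹).Finite) :
    (Subgroup.center N).FiniteIndex := by
  have hle : ⨅ s : S, Subgroup.centralizer {(s : N)} ≤ Subgroup.center N := by
    intro c hc
    rw [← Subgroup.centralizer_univ, ← Subgroup.coe_top, ← hgen, Subgroup.centralizer_closure]
    simp only [Subgroup.mem_iInf, Subgroup.mem_centralizer_singleton_iff] at hc ⊢
    exact fun s hs => (hc ⟨s, hs⟩).symm
  have : Finite S := hS
  have : ∀ s : S, (Subgroup.centralizer {(s : N)}).FiniteIndex := fun s => by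
    constructor
    have h1 := MulAction.index_stabilizer (ConjAct N) (s : N)
    rw [ConjAct.stabilizer_eq_centralizer] at h1
    have h2 : (MulAction.orbit (ConjAct N) (s : N)).ncard ≠ 0 :=
      Set.ncard_ne_zero_of_mem (MulAction.mem_orbit_self _) (hconj s s.2)
    rw [← h1] at h2
    exact h2
  have := Subgroup.finiteIndex_iInf this
  exact Subgroup.finiteIndex_of_le hle

/-- A commutator depends only on the cosets of its two entries modulo the center. -/
lemma finite_commutatorSet_of_finiteIndex_center {N : Type*} [Group N]
    [(Subgroup.center N).FiniteIndex] : (commutatorSet N).Finite := by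
  refine (Set.finite_range fun p : (N ⧸ Subgroup.center N) × (N ⧸ Subgroup.center N) =>
    p.1.out * p.2.out * p.1.out⁻¹ * p.2.out⁻¹).subset ?_
  rintro _ ⟨g, h, rfl⟩
  refine ⟨(g, h), ?_⟩
  obtain ⟨a, ha⟩ := QuotientGroup.mk_out_eq_mul (Subgroup.center N) g
  obtain ⟨b, hb⟩ := QuotientGroup.mk_out_eq_mul (Subgroup.center N) h
  have ha' := Subgroup.mem_center_iff.1 a.2
  have hb' := Subgroup.mem_center_iff.1 b.2
  show (g : N ⧸ Subgroup.center N).out * (h : N ⧸ Subgroup.center N).out *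
    (g : N ⧸ Subgroup.center N).out⁻¹ * (h : N ⧸ Subgroup.center N).out⁻¹ = _
  rw [ha, hb, commutatorElement_def]
  calc g * a * (h * b) * (g * a)⁻¹ * (h * b)⁻¹
      = g * (a * (h * b * (a : N)⁻¹)) * g⁻¹ * (h * b)⁻¹ := by group
    _ = g * h * (b * g⁻¹) * (h * b)⁻¹ := by rw [← ha' (h * b * (a : N)⁻¹)]; group
    _ = g * h * g⁻¹ * h⁻¹ := by rw [← hb' g⁻¹]; group

/-- Dietzmann's lemma, for a group generated by its torsion. -/
lemma finite_of_finite_generators {N : Type*} [Group N] {S : Set N} (hS : S.Finite)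
    (hgen : Subgroup.closure S = ⊤) (hconj : ∀ s ∈ S, (Set.range fun g => g * s * g⁻¹).Finite)
    (htor : ∀ s ∈ S, IsOfFinOrder s) : Finite N := by
  have := finiteIndex_center_of_finite_generators hS hgen hconj
  -- By Schur's theorem the commutator subgroup is then finite; it remains to see that the
  -- abelianization, finitely generated by torsion elements, is finite.
  have : Finite (commutatorSet N) := finite_commutatorSet_of_finiteIndex_center
  have hfg : Group.FG N := Group.fg_iff.2 ⟨S, hgen, hS⟩
  have hfgA : Group.FG (Abelianization N) := QuotientGroup.fg _
  have htop : CommGroup.torsion (Abelianization N) = ⊤ := by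
    rw [eq_top_iff]
    have h1 : Subgroup.map (Abelianization.of (G := N)) ⊤ = ⊤ := by
      rw [← MonoidHom.range_eq_map, MonoidHom.range_eq_top]
      exact QuotientGroup.mk_surjective
    rw [← h1, ← hgen, MonoidHom.map_closure, Subgroup.closure_le]
    rintro _ ⟨s, hs, rfl⟩
    exact (Abelianization.of (G := N)).isOfFinOrder (htor s hs)
  have hfin : Finite (Abelianization N) := by
    refine CommGroup.finite_of_fg_isMulTorsion _ ?_
    intro g
    have : g ∈ CommGroup.torsion (Abelianization N) := htop ▸ Subgroup.mem_top g
    exact this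
  have : Finite (N ⧸ commutator N) := hfin
  exact Finite.of_subgroup_quotient (commutator N)

/-- The conjugates of `x` are finitely many torsion generators of the normal closure `N`, and their
classes under `N` stay inside the finite class of `x` under `G`. -/
lemma finite_normalClosure {x : G} (hx : IsOfFinOrder x)
    (hconj : (Set.range fun g => g * x * g⁻¹).Finite) :
    Finite (Subgroup.normalClosure {x}) := by
  have hSeq : Group.conjugatesOfSet {x} = Set.range fun g => g * x * g⁻¹ := by
    ext y
    simp [Group.conjugatesOfSet, isConj_iff, conjugatesOf]
  have hle : Group.conjugatesOfSet {x} ⊆ (Subgroup.normalClosure {x} : Set G) :=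
    Subgroup.conjugatesOfSet_subset_normalClosure
  set N := Subgroup.normalClosure {x} with hN
  have hmem : ∀ s ∈ Group.conjugatesOfSet {x}, ∃ g, g * x * g⁻¹ = s := by
    rw [hSeq]; exact fun s hs => hs
  refine finite_of_finite_generators (S := ((↑) : N → G) ⁻¹' Group.conjugatesOfSet {x}) ?_ ?_ ?_ ?_
  · exact Set.Finite.preimage Subtype.val_injective.injOn (hSeq ▸ hconj)
  · have := Subgroup.closure_closure_coe_preimage (k := Group.conjugatesOfSet {x})
    exact this
  · intro s hs
    refine Set.Finite.of_finite_image (f := ((↑) : N → G)) ?_ Subtype.val_injective.injOn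
    refine hconj.subset ?_
    rintro _ ⟨_, ⟨g, rfl⟩, rfl⟩
    obtain ⟨h, hh⟩ := hmem s hs
    refine ⟨g * h, ?_⟩
    simp [← hh]
    group
  · intro s hs
    obtain ⟨h, hh⟩ := hmem s hs
    rw [← Submonoid.isOfFinOrder_coe, ← hh]
    exact (MulAut.conj h).toMonoidHom.isOfFinOrder hx

end FiniteNormal

/-! ### Primitive idempotents of reduced finite-dimensional commutative algebras. -/

section Idempotents

/-- A nonzero idempotent is primitive if it dominates no other nonzero idempotent. -/
def IsPrimitiveIdem {A : Type*} [CommRing A] (e : A) : Prop :=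
  IsIdempotentElem e ∧ e ≠ 0 ∧ ∀ f, IsIdempotentElem f → e * f = f → f = 0 ∨ f = e

/-- A reduced Artinian ring is the product of its residue fields. Over `ℂ` these are all `ℂ`, so the
algebra is `ℂ^k` and the coordinate idempotents `E I` form a basis. -/
lemma span_primitiveIdem_eq_top (A : Type*) [CommRing A] [Algebra ℂ A] [FiniteDimensional ℂ A]
    [IsReduced A] : Submodule.span ℂ {e : A | IsPrimitiveIdem e} = ⊤ := by
  classical
  have : IsArtinianRing A := IsArtinianRing.of_finite ℂ A
  let φ := IsArtinianRing.equivPi A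
  have hmax : ∀ I : MaximalSpectrum A, I.asIdeal.IsMaximal := fun I => I.2
  let E : MaximalSpectrum A → A := fun I => φ.symm (Pi.single I 1)
  have hφE : ∀ I, φ (E I) = Pi.single I 1 := fun I => φ.apply_symm_apply _
  have hE : ∀ I, IsPrimitiveIdem (E I) := by
    intro I
    refine ⟨?_, ?_, ?_⟩
    · apply φ.injective
      rw [map_mul, hφE, ← Pi.single_mul, one_mul]
    · intro h
      have h1 := congrFun (hφE I) I
      rw [h, map_zero, Pi.single_eq_same] at h1
      exact zero_ne_one h1
    · intro f hf hEf
      have h1 : φ f = Pi.single I (φ f I) := by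
        conv_lhs => rw [← hEf, map_mul, hφE]
        rw [← Pi.single_mul_left, one_mul]
      have h2 : IsIdempotentElem (φ f I) := congrFun (hf.map φ) I
      rcases IsIdempotentElem.iff_eq_zero_or_one.1 h2 with h | h
      · left
        apply φ.injective
        rw [h1, h, Pi.single_zero, map_zero]
      · right
        apply φ.injective
        rw [h1, h, hφE]
  have : Fintype (MaximalSpectrum A) := Fintype.ofFinite _
  rw [eq_top_iff]
  intro a _
  have hsurj : ∀ I : MaximalSpectrum A, ∃ c : ℂ, algebraMap ℂ (A ⧸ I.asIdeal) c = φ a I := fun I =>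
    (IsAlgClosed.algebraMap_bijective_of_isIntegral (k := ℂ) (K := A ⧸ I.asIdeal)).2 _
  choose c hc using hsurj
  have : a = ∑ I, c I • E I := by
    apply φ.injective
    simp only [Algebra.smul_def, map_sum, map_mul, hφE]
    ext J
    rw [Finset.sum_apply, Finset.sum_eq_single J]
    · simp [← hc]
      rfl
    · intro b _ hb
      simp [Pi.single_eq_of_ne hb.symm]
    · simp
  rw [this]
  exact sum_mem fun I _ => Submodule.smul_mem _ _ (Submodule.subset_span (hE I))

end Idempotents

/-! ### Traces of idempotents in the group ring of a finite group. -/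

section Trace

variable {L : Type*} [Group L] [Finite L]

/-- In the basis of group elements, every diagonal entry of left multiplication by `a` is the
coefficient of `a` at `1`. -/
lemma trace_mulLeft (a : MonoidAlgebra ℂ L) :
    LinearMap.trace ℂ _ (LinearMap.mulLeft ℂ a) = Nat.card L * a.coeff 1 := by
  classical
  have := Fintype.ofFinite L
  rw [LinearMap.trace_eq_matrix_trace ℂ (MonoidAlgebra.basis L ℂ), Matrix.trace]
  have : ∀ g : L, (LinearMap.toMatrix (MonoidAlgebra.basis L ℂ) (MonoidAlgebra.basis L ℂ)
      (LinearMap.mulLeft ℂ a)).diag g = a.coeff 1 := fun g => by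
    rw [Matrix.diag_apply, LinearMap.toMatrix_apply]
    show (a * MonoidAlgebra.single g 1).coeff g = _
    rw [MonoidAlgebra.coeff_mul_single_eq_coeff_mul 1 (by simp), mul_one]
  rw [Finset.sum_congr rfl fun g _ => this g]
  simp

lemma exists_nat_of_isIdempotentElem {e : MonoidAlgebra ℂ L} (he : IsIdempotentElem e) :
    ∃ m : ℕ, (Nat.card L : ℂ) * e.coeff 1 = m := by
  have h : IsIdempotentElem (LinearMap.mulLeft ℂ e) := by
    refine LinearMap.ext fun x => ?_
    show e * (e * x) = e * x
    rw [← mul_assoc, he.eq]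
  exact ⟨_, (trace_mulLeft e).symm.trans (LinearMap.IsIdempotentElem.isProj_range _ h).trace⟩

end Trace

/-! ### The number `lcm(G)` and finiteness of `Δ⁺`. -/

section Lcm

variable (G : Type*) [Group G]

/-- A finite infimum means that common multiples exist; an infimum of a nonempty set in `ℕ∞` is
attained, so it is itself a positive common multiple. -/
lemma lcmG_toNat_spec (hG : lcmG G < ⊤) :
    0 < (lcmG G).toNat ∧ ∀ H : Subgroup G, Finite H → Nat.card H ∣ (lcmG G).toNat := by
  have h1 : lcmG G = sInf ((fun m : ℕ => (m : ℕ∞)) ''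
      {m : ℕ | 0 < m ∧ ∀ H : Subgroup G, Finite H → Nat.card H ∣ m}) := by
    rw [sInf_image]; rfl
  have hne : ((fun m : ℕ => (m : ℕ∞)) ''
      {m : ℕ | 0 < m ∧ ∀ H : Subgroup G, Finite H → Nat.card H ∣ m}).Nonempty := by
    by_contra h
    rw [Set.not_nonempty_iff_eq_empty] at h
    rw [h1, h, sInf_empty] at hG
    exact lt_irrefl _ hG
  obtain ⟨m, hm, hm'⟩ := csInf_mem hne
  rw [h1, ← hm']
  exact hm

variable {G}

lemma finite_sup_of_normal (H N : Subgroup G) [N.Normal] [Finite H] [Finite N] :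
    Finite (H ⊔ N : Subgroup G) := by
  have h : ((H ⊔ N : Subgroup G) : Set G).Finite := by
    rw [Subgroup.mul_normal]
    exact Set.Finite.mul (Set.toFinite _) (Set.toFinite _)
  exact h

/-- Orders of finite normal subgroups are bounded by `lcm(G)`. One of maximal order absorbs every
other `M`, because its join with `M` is again finite and normal. -/
lemma deltaPlus_normal_finite (hG : lcmG G < ⊤) :
    (deltaPlus G).Normal ∧ Finite (deltaPlus G) := by
  obtain ⟨hd, hdvd⟩ := lcmG_toNat_spec G hG
  let s : Set ℕ := {k | ∃ N : Subgroup G, N.Normal ∧ Finite N ∧ Nat.card N = k}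
  have hs : BddAbove s := ⟨(lcmG G).toNat, by
    rintro _ ⟨N, -, hN, rfl⟩
    exact Nat.le_of_dvd hd (hdvd N hN)⟩
  have hne : s.Nonempty := ⟨_, ⊥, inferInstance, inferInstance, rfl⟩
  obtain ⟨N, hN, hNf, hcard⟩ := Nat.sSup_mem hne hs
  have : deltaPlus G = N := by
    refine le_antisymm (iSup₂_le fun M hM => ?_) (le_iSup₂_of_le N ⟨hN, hNf⟩ le_rfl)
    obtain ⟨hM, hMf⟩ := hM
    have hfin := finite_sup_of_normal M N
    have hle : Nat.card (M ⊔ N : Subgroup G) ≤ Nat.card N := by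
      rw [hcard]
      exact le_csSup hs ⟨_, inferInstance, hfin, rfl⟩
    exact le_sup_left.trans (Subgroup.eq_of_le_of_card_ge le_sup_right hle).ge
  rw [this]
  exact ⟨hN, hNf⟩

lemma mem_deltaPlus_of_finite_conj {x : G} (hx : IsOfFinOrder x)
    (hconj : (Set.range fun g => g * x * g⁻¹).Finite) : x ∈ deltaPlus G := by
  have hle : Subgroup.normalClosure {x} ≤ deltaPlus G :=
    le_iSup₂_of_le (Subgroup.normalClosure {x})
      ⟨Subgroup.normalClosure_normal, finite_normalClosure hx hconj⟩ le_rfl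
  exact hle (Subgroup.subset_normalClosure rfl)

end Lcm

/-! ### Group rings of subgroups inside `ℂ[G]`. -/

section GroupRing

variable {G : Type*} [Group G]

/-- `ℂ[H]` inside `ℂ[G]`. -/
noncomputable def subgroupRing (H : Subgroup G) : Subalgebra ℂ (MonoidAlgebra ℂ G) :=
  (MonoidAlgebra.mapDomainAlgHom ℂ ℂ H.subtype).range

lemma mem_subgroupRing {H : Subgroup G} {a : MonoidAlgebra ℂ G} :
    a ∈ subgroupRing H ↔ ∀ g, g ∉ H → a.coeff g = 0 := by
  constructor
  · rintro ⟨b, rfl⟩ g hg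
    show (MonoidAlgebra.mapDomain H.subtype b).coeff g = 0
    exact Finsupp.mapDomain_of_notMem_range _ _ (by simpa using hg)
  · intro h
    refine ⟨MonoidAlgebra.comapDomain H.subtype H.subtype_injective a, ?_⟩
    refine MonoidAlgebra.mapDomain_comapDomain (fun g hg => ?_) H.subtype_injective
    by_contra hgH
    exact Finsupp.mem_support_iff.1 hg (h g (by simpa using hgH))

lemma inGroupRing_univ_iff {H : Subgroup G} {a : MonoidAlgebra ℂ G} :
    InGroupRing Set.univ H a ↔ a ∈ subgroupRing H := by
  rw [mem_subgroupRing]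
  exact ⟨fun h => h.2, fun h => ⟨fun _ => trivial, h⟩⟩

lemma subgroupRing_mono {H L : Subgroup G} (h : H ≤ L) : subgroupRing H ≤ subgroupRing L :=
  fun a ha => by
    rw [mem_subgroupRing] at ha ⊢
    exact fun g hg => ha g fun hgH => hg (h hgH)

instance (H : Subgroup G) [Finite H] : FiniteDimensional ℂ (subgroupRing H) := by
  have : FiniteDimensional ℂ (MonoidAlgebra ℂ H) :=
    Module.Finite.of_basis (MonoidAlgebra.basis H ℂ)
  exact Module.Finite.of_surjective
    (MonoidAlgebra.mapDomainAlgHom ℂ ℂ H.subtype).rangeRestrict.toLinearMap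
    (MonoidAlgebra.mapDomainAlgHom ℂ ℂ H.subtype).rangeRestrict_surjective

/-- The trace of an idempotent in the group ring of a finite subgroup. -/
lemma exists_nat_of_isIdempotentElem_subgroupRing {H : Subgroup G} [Finite H]
    {e : MonoidAlgebra ℂ G} (he : IsIdempotentElem e) (heH : e ∈ subgroupRing H) :
    ∃ m : ℕ, (Nat.card H : ℂ) * e.coeff 1 = m := by
  obtain ⟨b, rfl⟩ := heH
  have hinj : Function.Injective (MonoidAlgebra.mapDomainAlgHom ℂ ℂ H.subtype) :=
    MonoidAlgebra.mapDomain_injective H.subtype_injective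
  have hb : IsIdempotentElem b := hinj (by rw [map_mul]; exact he)
  obtain ⟨m, hm⟩ := exists_nat_of_isIdempotentElem hb
  refine ⟨m, ?_⟩
  rw [← hm]
  congr 1
  exact Finsupp.mapDomain_apply H.subtype_injective b.coeff 1

end GroupRing

/-! ### Group ring elements as vectors of `ℓ²(G)`. -/

section Regular

variable {G : Type*} [Group G]

lemma inner_deltaOne (f : L2 G) : ⟪deltaOne G, f⟫_ℂ = f 1 := by
  classical
  rw [deltaOne, lp.inner_single_left]
  simp

lemma rightTrans_deltaOne_apply [DecidableEq G] (h x : G) :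
    rightTrans h (deltaOne G) x = if x = h then 1 else 0 := by
  rw [rightTrans_apply, deltaOne_apply]
  simp [mul_inv_eq_one]

lemma groupRingToNG_of (g : G) :
    ((groupRingToNG G (MonoidAlgebra.of ℂ G g) : NG G) : Op G) = leftRegular G g := by
  show groupRingRep G _ = _
  simp [groupRingRep]

lemma groupRingToNG_deltaOne (a : MonoidAlgebra ℂ G) (x : G) :
    (groupRingToNG G a : Op G) (deltaOne G) x = a.coeff x := by
  classical
  show groupRingRep G a (deltaOne G) x = _
  induction a using MonoidAlgebra.induction_on with
  | of g =>
    rw [groupRingRep, MonoidAlgebra.lift_of, leftRegular_deltaOne, rightTrans_deltaOne_apply]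
    simp [MonoidAlgebra.of, Finsupp.single_apply, eq_comm]
  | add a b ha hb => simp [← ha, ← hb]
  | smul r a ha => simp [← ha]

lemma groupRingToNG_injective : Function.Injective (groupRingToNG G) := fun a b h => by
  ext x
  rw [← groupRingToNG_deltaOne, h, groupRingToNG_deltaOne]

lemma trG_groupRingToNG (a : MonoidAlgebra ℂ G) : trG G (groupRingToNG G a) = a.coeff 1 := by
  rw [trG, inner_deltaOne, groupRingToNG_deltaOne]

end Regular

/-! ### Where the center-valued trace lands, and idempotents of the center. -/

section CenterTrace

variable {G : Type*} [Group G]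

/-- A nonzero constant is not square-summable over an infinite class. -/
lemma classFunctions_eq_zero_of_infinite {u : L2 G} (hu : u ∈ classFunctions G) {x : G}
    (hx : (Set.range fun g => g * x * g⁻¹).Infinite) : u x = 0 := by
  by_contra h
  have h2 : (0 : ℝ) < (2 : ENNReal).toReal := by norm_num
  have hsum := ((memℓp_gen_iff h2).1 (lp.memℓp u)).tendsto_cofinite_zero
  have hpos : 0 < ‖u x‖ ^ (2 : ENNReal).toReal := by positivity
  have hev := hsum.eventually_lt_const hpos
  refine hx (Set.Finite.subset (Filter.eventually_cofinite.1 hev) ?_)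
  rintro _ ⟨g, rfl⟩
  simp [hu g x]

lemma starProjection_eq_zero_of_infinite {x : G}
    (hx : (Set.range fun g => g * x * g⁻¹).Infinite) :
    (classFunctions G).starProjection (rightTrans x (deltaOne G)) = 0 := by
  classical
  rw [Submodule.starProjection_apply_eq_zero_iff, Submodule.mem_orthogonal]
  intro u hu
  rw [← single_eq, lp.inner_single_right, classFunctions_eq_zero_of_infinite hu hx]
  simp

/-- Since `δ_e` is separating, `T` equals the group ring element whose coefficients are the finitely
many nonzero values of `T δ_e`. -/
lemma exists_mem_subgroupRing {N : Subgroup G} [Finite N] {T : NG G}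
    (hT : ∀ g, g ∉ N → (T : Op G) (deltaOne G) g = 0) :
    T ∈ (subgroupRing N).map (groupRingToNG G) := by
  classical
  have hfin : (N : Set G).Finite := Set.toFinite _
  refine ⟨.ofCoeff (Finsupp.onFinset hfin.toFinset ((T : Op G) (deltaOne G)) fun g hg => ?_),
    mem_subgroupRing.2 hT, NG_ext ?_⟩
  · by_contra h
    exact hg (hT g (by simpa using h))
  · ext x
    exact groupRingToNG_deltaOne _ x

/-- The functions supported on `N` form a closed convex set that, by normality, contains all
conjugates of `a δ_e`; `proj_mem` then puts the projection in it. -/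
lemma centerTrace_mem_of_normal {N : Subgroup G} [N.Normal] [Finite N] {a : MonoidAlgebra ℂ G}
    (ha : a ∈ subgroupRing N) :
    (centerTrace G (groupRingToNG G a) : NG G) ∈ (subgroupRing N).map (groupRingToNG G) := by
  refine exists_mem_subgroupRing ?_
  rw [centerTrace_deltaOne]
  refine proj_mem (C := {f : L2 G | ∀ g, g ∉ N → f g = 0}) ?_ ?_ ?_
  · simp only [Set.ofPred_forall]
    exact isClosed_iInter fun g => isClosed_iInter fun _ =>
      isClosed_eq (lp.evalCLM ℂ (fun _ : G => ℂ) 2 g).continuous continuous_const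
  · intro f hf h hh s t _ _ _ g hg
    show (s : ℂ) * f g + (t : ℂ) * h g = 0
    rw [hf g hg, hh g hg, mul_zero, mul_zero, add_zero]
  · intro g x hx
    rw [conjIsometry_apply, groupRingToNG_deltaOne]
    refine mem_subgroupRing.1 ha _ fun h => hx ?_
    have := Subgroup.Normal.conj_mem ‹N.Normal› _ h g
    group at this
    exact this

/-- By linearity it suffices to treat one `h ∈ H`: a finite class puts `h` in `Δ⁺`, an infinite one
makes the trace zero. -/
lemma centerTrace_mem {H : Subgroup G} [Finite H] (hG : lcmG G < ⊤) {a : MonoidAlgebra ℂ G}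
    (ha : a ∈ subgroupRing H) :
    (centerTrace G (groupRingToNG G a) : NG G) ∈
      (subgroupRing (deltaPlus G)).map (groupRingToNG G) := by
  obtain ⟨hn, hf⟩ := deltaPlus_normal_finite hG
  obtain ⟨b, rfl⟩ := ha
  induction b using MonoidAlgebra.induction_on with
  | of h =>
    have h1 : MonoidAlgebra.mapDomainAlgHom ℂ ℂ H.subtype (MonoidAlgebra.of ℂ H h) =
      MonoidAlgebra.of ℂ G (h : G) := by simp
    simp only [AlgHom.toRingHom_eq_coe, RingHom.coe_coe]
    rw [h1]
    by_cases hc : (Set.range fun g => g * (h : G) * g⁻¹).Finite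
    · refine centerTrace_mem_of_normal (mem_subgroupRing.2 fun g hg => ?_)
      have hmem := mem_deltaPlus_of_finite_conj
        (Submonoid.isOfFinOrder_coe.2 (isOfFinOrder_of_finite h)) hc
      have hne : (h : G) ≠ g := fun e => hg (e ▸ hmem)
      simp [MonoidAlgebra.of, hne]
    · have h0 : (centerTrace G (groupRingToNG G (MonoidAlgebra.of ℂ G (h : G))) : NG G) = 0 := by
        refine NG_ext ?_
        rw [centerTrace_deltaOne, groupRingToNG_of, leftRegular_deltaOne,
          starProjection_eq_zero_of_infinite hc]
        rfl
      rw [h0]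
      exact zero_mem _
  | add a b ha hb => simp only [map_add] at ha hb ⊢; exact add_mem ha hb
  | smul r a ha =>
    simp only [map_smul, AlgHom.toRingHom_eq_coe, RingHom.coe_coe] at ha ⊢
    exact Subalgebra.smul_mem _ ha _

lemma inner_star_apply (a : NG G) (v w : L2 G) :
    ⟪((star a : NG G) : Op G) v, w⟫_ℂ = ⟪v, (a : Op G) w⟫_ℂ := by
  show ⟪(star (a : Op G)) v, w⟫_ℂ = _
  rw [ContinuousLinearMapWOT.star_apply, ContinuousLinearMap.star_eq_adjoint,
    ContinuousLinearMap.adjoint_inner_left]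
  rfl

lemma star_mem_ZNG {z : NG G} (hz : z ∈ ZNG G) : star z ∈ ZNG G := by
  rw [Subalgebra.mem_center_iff] at hz ⊢
  intro b
  have := congrArg star (hz (star b))
  simpa using this.symm

variable (G) in
/-- The canonical trace as a linear functional. -/
noncomputable def trLin : NG G →ₗ[ℂ] ℂ where
  toFun := trG G
  map_add' _ _ := inner_add_right _ _ _
  map_smul' _ _ := inner_smul_right _ _ _

/-- Both sides are pairings with `c* δ_e`, which is a class function; the self-adjoint projection
onto class functions fixes it. -/
lemma trG_centerTrace_mul (a : NG G) (c : ZNG G) :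
    trG G ((centerTrace G a * c : ZNG G) : NG G) = trG G (a * (c : NG G)) := by
  have hc := Subalgebra.mem_center_iff.1 c.2
  have hstar := central_mem_classFunctions G ⟨star (c : NG G), star_mem_ZNG c.2⟩
  rw [Subalgebra.coe_mul, hc a, hc]
  show ⟪deltaOne G, ((c : NG G) : Op G) (((centerTrace G a : NG G) : Op G) (deltaOne G))⟫_ℂ =
    ⟪deltaOne G, ((c : NG G) : Op G) ((a : Op G) (deltaOne G))⟫_ℂ
  rw [← inner_star_apply (c : NG G), ← inner_star_apply (c : NG G), centerTrace_deltaOne,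
    ← Submodule.inner_starProjection_left_eq_right, Submodule.starProjection_eq_self_iff.2 hstar]

lemma trG_star_mul_self (a : NG G) : trG G (star a * a) =
    ⟪(a : Op G) (deltaOne G), (a : Op G) (deltaOne G)⟫_ℂ := by
  have h := inner_star_apply (star a) (deltaOne G) ((a : Op G) (deltaOne G))
  rw [star_star] at h
  exact h.symm

lemma eq_zero_of_trG_star_mul_self {a : NG G} (h : trG G (star a * a) = 0) : a = 0 := by
  rw [trG_star_mul_self, inner_self_eq_zero] at h
  exact NG_ext h

lemma trG_ne_zero {e : NG G} (he : IsStarProjection e) (h0 : e ≠ 0) : trG G e ≠ 0 := by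
  intro h
  refine h0 (eq_zero_of_trG_star_mul_self ?_)
  rw [he.isSelfAdjoint.star_eq, he.isIdempotentElem.eq, h]

lemma eq_zero_of_star_mul_self {a : NG G} (h : star a * a = 0) : a = 0 :=
  eq_zero_of_trG_star_mul_self (by rw [h]; exact (trLin G).map_zero)

/-- If `z` is central with `z² = 0`, then `b = z* z` satisfies `b* b = 0`. Faithfulness of the trace
gives `b = 0`, and then `z = 0`. -/
lemma isReduced_ZNG : IsReduced (ZNG G) := by
  refine (isReduced_iff_pow_one_lt 2 one_lt_two).2 fun z hz => ?_
  have hz' : (z : NG G) * z = 0 := by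
    rw [sq] at hz
    exact congrArg Subtype.val hz
  have hc := Subalgebra.mem_center_iff.1 z.2
  refine Subtype.ext (eq_zero_of_star_mul_self (eq_zero_of_star_mul_self ?_))
  rw [star_mul, star_star, hc, mul_assoc, ← mul_assoc (star (z : NG G)), hc,
    mul_assoc, ← mul_assoc, hz', zero_mul]

lemma idempotent_sub_mul {R : Type*} [CommRing R] {e f : R} (he : IsIdempotentElem e)
    (hf : IsIdempotentElem f) : (f - e * f) * (e - e * f) = 0 := by
  have he' : e * e = e := he
  have hf' : f * f = f := hf
  -- The product factors as `(f² - f)(e² - e)`.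
  linear_combination (f * f - f) * he' + 0 * hf'

/-- With `x = e - e e*`, centrality gives `x* x = (e* - e e*)(e - e e*) = 0`. Hence `e = e e*`,
which is self-adjoint. -/
lemma isStarProjection_of_isIdempotentElem {e : ZNG G} (he : IsIdempotentElem e) :
    IsStarProjection (e : NG G) := by
  have he' : (e : NG G) * e = e := congrArg Subtype.val he
  have hfi : star (e : NG G) * star (e : NG G) = star (e : NG G) := by
    have := congrArg star he'
    rwa [star_mul] at this
  have hx : (e : NG G) - e * star (e : NG G) = 0 := by
    refine eq_zero_of_star_mul_self ?_
    have h1 := idempotent_sub_mul (R := ZNG G) (f := ⟨star (e : NG G), star_mem_ZNG e.2⟩) he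
      (Subtype.ext hfi)
    have h2 := congrArg Subtype.val h1
    rw [star_sub, star_mul, star_star]
    exact h2
  refine ⟨he', ?_⟩
  rw [sub_eq_zero.1 hx]
  exact IsSelfAdjoint.mul_star_self _

end CenterTrace

section Shortcuts

variable (G : Type*) [Group G]

/-! Shortcut instances: instance search on `ZNG G` is slow. -/

noncomputable abbrev commRingZNG : CommRing (ZNG G) := inferInstance

attribute [local instance] commRingZNG

noncomputable abbrev ringZNG : Ring (ZNG G) := inferInstance
noncomputable abbrev addCommGroupZNG : AddCommGroup (ZNG G) := inferInstance
noncomputable abbrev addGroupZNG : AddGroup (ZNG G) := inferInstance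
noncomputable abbrev semigroupZNG : Semigroup (ZNG G) := inferInstance
noncomputable abbrev semiringZNG : NonUnitalNonAssocSemiring (ZNG G) := inferInstance
noncomputable abbrev moduleZNG : Module ℂ (ZNG G) := inferInstance

end Shortcuts

/-! ### The algebra `Z(N(G)) ∩ ℂ[Δ⁺]` and its basis of primitive projections. -/

section CentralRing

attribute [local instance] commRingZNG ringZNG addCommGroupZNG addGroupZNG semigroupZNG
  semiringZNG moduleZNG

variable (G : Type*) [Group G]

/-- The commutative algebra `Z(N(G)) ∩ ℂ[Δ⁺(G)]`. -/
noncomputable def centralRing : Subalgebra ℂ (ZNG G) :=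
  ((subgroupRing (deltaPlus G)).map (groupRingToNG G)).comap (ZNG G).val

noncomputable abbrev commRingCentralRing : CommRing (centralRing G) := inferInstance
noncomputable abbrev addCommGroupCentralRing : AddCommGroup (centralRing G) := inferInstance

attribute [local instance] commRingCentralRing addCommGroupCentralRing

variable {G}

/-- Self-adjointness is automatic for central idempotents, so primitive projections can be handled
as purely algebraic primitive idempotents. -/
lemma mem_centralProj_iff {e : ZNG G} :
    e ∈ centralProj G ↔ IsIdempotentElem e ∧ e ∈ centralRing G := by
  constructor
  · rintro ⟨he, a, ha, hae⟩
    exact ⟨Subtype.ext he.isIdempotentElem, a, inGroupRing_univ_iff.1 ha, hae⟩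
  · rintro ⟨he, a, ha, hae⟩
    exact ⟨isStarProjection_of_isIdempotentElem he, a, inGroupRing_univ_iff.2 ha, hae⟩

lemma finiteDimensional_centralRing (hG : lcmG G < ⊤) : FiniteDimensional ℂ (centralRing G) := by
  obtain ⟨-, hf⟩ := deltaPlus_normal_finite hG
  have h1 : FiniteDimensional ℂ
      ((subgroupRing (deltaPlus G)).toSubmodule.map (groupRingToNG G).toLinearMap) :=
    have : FiniteDimensional ℂ (subgroupRing (deltaPlus G)).toSubmodule :=
      inferInstanceAs (FiniteDimensional ℂ (subgroupRing (deltaPlus G)))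
    inferInstance
  let f : centralRing G →ₗ[ℂ]
      ((subgroupRing (deltaPlus G)).toSubmodule.map (groupRingToNG G).toLinearMap) :=
    LinearMap.codRestrict _ ((ZNG G).val.toLinearMap ∘ₗ (centralRing G).val.toLinearMap)
      fun x => x.2
  have := isNoetherian_of_isNoetherianRing_of_finite ℂ
      ((subgroupRing (deltaPlus G)).toSubmodule.map (groupRingToNG G).toLinearMap)
  refine Module.Finite.of_injective f fun x y h => ?_
  have h' : ((f x : _) : NG G) = f y := congrArg Subtype.val h
  exact Subtype.ext (Subtype.ext h')

lemma primitiveCentralProj_of_isPrimitiveIdem {e : centralRing G} (he : IsPrimitiveIdem e) :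
    (e : ZNG G) ∈ primitiveCentralProj G := by
  obtain ⟨h1, h2, h3⟩ := he
  refine ⟨mem_centralProj_iff.2 ⟨congrArg Subtype.val h1, e.2⟩,
    fun h => h2 (Subtype.ext h), fun f hf hef => ?_⟩
  obtain ⟨hfi, hfm⟩ := mem_centralProj_iff.1 hf
  refine (h3 ⟨f, hfm⟩ (Subtype.ext hfi) (Subtype.ext hef)).imp (congrArg Subtype.val)
    (congrArg Subtype.val)

lemma mem_span_primitiveCentralProj (hG : lcmG G < ⊤) {z : ZNG G} (hz : z ∈ centralRing G) :
    z ∈ Submodule.span ℂ (primitiveCentralProj G) := by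
  have := finiteDimensional_centralRing hG
  have := isReduced_ZNG (G := G)
  have : IsReduced (centralRing G) :=
    isReduced_of_injective (centralRing G).val Subtype.val_injective
  have h : (⟨z, hz⟩ : centralRing G) ∈ Submodule.span ℂ {e | IsPrimitiveIdem e} :=
    span_primitiveIdem_eq_top (centralRing G) ▸ Submodule.mem_top
  have h2 := Submodule.mem_map_of_mem (f := (centralRing G).val.toLinearMap) h
  rw [Submodule.map_span] at h2
  refine Submodule.span_mono ?_ h2
  rintro _ ⟨e, he, rfl⟩
  exact primitiveCentralProj_of_isPrimitiveIdem he

/-- `P * Q` lies below both factors; were it nonzero, minimality would make it equal to each. -/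
lemma primitiveCentralProj_orthogonal {P Q : ZNG G} (hP : P ∈ primitiveCentralProj G)
    (hQ : Q ∈ primitiveCentralProj G) (hPQ : P ≠ Q) : P * Q = 0 := by
  obtain ⟨hP1, -, hP3⟩ := hP
  obtain ⟨hQ1, -, hQ3⟩ := hQ
  rw [mem_centralProj_iff] at hP1 hQ1
  have hmem : P * Q ∈ centralProj G :=
    mem_centralProj_iff.2 ⟨hP1.1.mul hQ1.1, mul_mem hP1.2 hQ1.2⟩
  rcases hP3 _ hmem (by rw [← mul_assoc, hP1.1.eq]) with h | h
  · exact h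
  rcases hQ3 _ hmem (by rw [mul_left_comm, hQ1.1.eq]) with h' | h'
  · exact h'
  · exact absurd (h.symm.trans h') hPQ

lemma trG_primitive_ne_zero {P : ZNG G} (hP : P ∈ primitiveCentralProj G) :
    trG G (P : NG G) ≠ 0 :=
  trG_ne_zero hP.1.1 fun h => hP.2.1 (Subtype.ext h)

variable (G) in
/-- The functional `z ↦ tr_G(z P)` on the center. -/
noncomputable def trMul (P : ZNG G) : ZNG G →ₗ[ℂ] ℂ :=
  trLin G ∘ₗ (ZNG G).val.toLinearMap ∘ₗ LinearMap.mulRight ℂ P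

lemma trMul_apply (P z : ZNG G) : trMul G P z = trG G ((z * P : ZNG G) : NG G) := rfl

lemma trMul_primitive {P Q : ZNG G} (hP : P ∈ primitiveCentralProj G)
    (hQ : Q ∈ primitiveCentralProj G) [Decidable (Q = P)] :
    trMul G P Q = if Q = P then trG G (P : NG G) else 0 := by
  rw [trMul_apply]
  split_ifs with h
  · rw [h, (mem_centralProj_iff.1 hP.1).1.eq]
  · rw [primitiveCentralProj_orthogonal hQ hP h]
    exact (trLin G).map_zero

/-- The functionals `trMul G P` are dual to the `P^i` up to the nonzero factors `tr_G(P^i)`. -/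
lemma linearIndependent_primitiveCentralProj :
    LinearIndependent ℂ fun P : primitiveCentralProj G => (P : ZNG G) := by
  classical
  rw [linearIndependent_iff']
  intro s c hc P hP
  have h := congrArg (trMul G P) hc
  rw [map_sum, map_zero, Finset.sum_eq_single P] at h
  · rw [map_smul, trMul_primitive P.2 P.2, if_pos rfl] at h
    exact (smul_eq_zero.1 h).resolve_right (trG_primitive_ne_zero P.2)
  · intro Q _ hQ
    rw [map_smul, trMul_primitive P.2 Q.2, if_neg fun h => hQ (Subtype.ext h), smul_zero]
  · exact fun h => absurd hP h

lemma finite_primitiveCentralProj (hG : lcmG G < ⊤) : (primitiveCentralProj G).Finite := by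
  have := finiteDimensional_centralRing hG
  let v : primitiveCentralProj G → centralRing G := fun P =>
    ⟨P, (mem_centralProj_iff.1 P.2.1).2⟩
  have hv : LinearIndependent ℂ v := by
    refine LinearIndependent.of_comp (centralRing G).val.toLinearMap ?_
    exact linearIndependent_primitiveCentralProj
  exact hv.finite

/-- Both sides are linear in `z`, so orthogonality reduces the expansion to `z` primitive. -/
lemma eq_sum_primitiveCentralProj (hG : lcmG G < ⊤) {z : ZNG G} (hz : z ∈ centralRing G) :
    z = ∑ P ∈ (finite_primitiveCentralProj hG).toFinset,
      (trMul G P z / trG G (P : NG G)) • P := by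
  classical
  have hs := mem_span_primitiveCentralProj hG hz
  clear hz
  induction hs using Submodule.span_induction with
  | mem Q hQ =>
    rw [Finset.sum_eq_single Q]
    · rw [trMul_primitive hQ hQ, if_pos rfl, div_self (trG_primitive_ne_zero hQ), one_smul]
    · intro P hP hPQ
      rw [trMul_primitive (by simpa using hP) hQ, if_neg hPQ.symm, zero_div, zero_smul]
    · simp [hQ]
  | zero => simp
  | add x y _ _ h1 h2 =>
    simp only [map_add, add_div, add_smul, Finset.sum_add_distrib]
    rw [← h1, ← h2]
  | smul r x _ h1 =>
    simp only [map_smul, smul_eq_mul, mul_div_assoc, mul_smul]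
    rw [← Finset.smul_sum, ← h1]

end CentralRing

/-! ### Integrality of the coordinates of `L_K(G)`. -/

section Lattice

attribute [local instance] commRingZNG ringZNG addCommGroupZNG addGroupZNG semigroupZNG
  semiringZNG moduleZNG

variable {G : Type*} [Group G] {K : Subring ℂ}

lemma LK_le_centralRing (hG : lcmG G < ⊤) :
    LK G K ≤ (centralRing G).toSubmodule.toAddSubgroup := by
  refine (AddSubgroup.closure_le _).2 ?_
  rintro _ ⟨H, hH, P, hPH, -, rfl⟩
  exact centerTrace_mem hG (mem_subgroupRing.2 hPH.2)

/-- The value is `lcm(G) tr_G(P q)`, where `q ∈ ℂ[Δ⁺]` represents `Q`; the idempotent `P q` lives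
over the finite group `H ⊔ Δ⁺`. -/
lemma trMul_centerTrace_integral (hG : lcmG G < ⊤) {H : Subgroup G} [Finite H]
    {P : MonoidAlgebra ℂ G} (hPH : P ∈ subgroupRing H) (hP : IsStarProjection (groupRingToNG G P))
    {Q : ZNG G} (hQ : Q ∈ primitiveCentralProj G) :
    ∃ m : ℤ, ((lcmG G).toNat : ℂ) * trMul G Q (centerTrace G (groupRingToNG G P)) = m := by
  obtain ⟨hn, hf⟩ := deltaPlus_normal_finite hG
  obtain ⟨-, hdvd⟩ := lcmG_toNat_spec G hG
  obtain ⟨hQi, q, hq, hqQ⟩ := mem_centralProj_iff.1 hQ.1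
  have hqQ' : groupRingToNG G q = (Q : NG G) := hqQ
  have hfin := finite_sup_of_normal H (deltaPlus G)
  have hQi' : (Q : NG G) * Q = Q := congrArg Subtype.val hQi
  have hcomm := Subalgebra.mem_center_iff.1 Q.2
  have hidem : IsIdempotentElem (P * q) := by
    refine groupRingToNG_injective ?_
    rw [map_mul, map_mul, hqQ', mul_assoc, ← mul_assoc (Q : NG G), ← hcomm, mul_assoc, hQi',
      ← mul_assoc, hP.isIdempotentElem.eq]
  obtain ⟨m, hm⟩ := exists_nat_of_isIdempotentElem_subgroupRing hidem
    (mul_mem (subgroupRing_mono (le_sup_left : H ≤ H ⊔ deltaPlus G) hPH)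
      (subgroupRing_mono le_sup_right hq))
  obtain ⟨k, hk⟩ := hdvd _ hfin
  -- Here `m` is the rank of `P q` acting on `ℂ[H ⊔ Δ⁺]`, and `k` is the cofactor `lcm(G) / |H ⊔
  -- Δ⁺|`.
  refine ⟨k * m, ?_⟩
  rw [trMul_apply, trG_centerTrace_mul, ← hqQ', ← map_mul, trG_groupRingToNG, hk]
  push_cast
  rw [← hm]
  ring

lemma trMul_integral (hG : lcmG G < ⊤) {z : ZNG G} (hz : z ∈ LK G K)
    {Q : ZNG G} (hQ : Q ∈ primitiveCentralProj G) :
    ∃ m : ℤ, ((lcmG G).toNat : ℂ) * trMul G Q z = m := by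
  induction hz using AddSubgroup.closure_induction with
  | mem z hz =>
    obtain ⟨H, hH, P, hPH, hP, rfl⟩ := hz
    exact trMul_centerTrace_integral hG (mem_subgroupRing.2 hPH.2) hP hQ
  | zero => exact ⟨0, by simp⟩
  | add x y _ _ hx hy =>
    obtain ⟨m, hm⟩ := hx
    obtain ⟨n, hn⟩ := hy
    exact ⟨m + n, by rw [map_add, mul_add, hm, hn]; push_cast; rfl⟩
  | neg x _ hx =>
    obtain ⟨m, hm⟩ := hx
    exact ⟨-m, by rw [map_neg, mul_neg, hm]; push_cast; rfl⟩

lemma LK_le_closure (hG : lcmG G < ⊤) : LK G K ≤ AddSubgroup.closure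
    ((fun P : ZNG G => (((lcmG G).toNat : ℂ) * trG G (P : NG G))⁻¹ • P) ''
      primitiveCentralProj G) := by
  intro z hz
  have hd : ((lcmG G).toNat : ℂ) ≠ 0 := Nat.cast_ne_zero.2 (lcmG_toNat_spec G hG).1.ne'
  rw [eq_sum_primitiveCentralProj hG (LK_le_centralRing hG hz)]
  refine sum_mem fun P hP => ?_
  have hP' : P ∈ primitiveCentralProj G := by simpa using hP
  obtain ⟨m, hm⟩ := trMul_integral hG hz hP'
  have : (trMul G P z / trG G (P : NG G)) • P =
      m • ((((lcmG G).toNat : ℂ) * trG G (P : NG G))⁻¹ • P) := by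
    rw [← Int.cast_smul_eq_zsmul ℂ m, smul_smul, ← hm]
    congr 1
    have := trG_primitive_ne_zero hP'
    field_simp
  rw [this]
  exact zsmul_mem (AddSubgroup.subset_closure (Set.mem_image_of_mem _ hP')) m

lemma LK_ext (hG : lcmG G < ⊤) {z w : ZNG G} (hz : z ∈ LK G K) (hw : w ∈ LK G K)
    (h : ∀ P ∈ primitiveCentralProj G, trMul G P z = trMul G P w) : z = w := by
  rw [eq_sum_primitiveCentralProj hG (LK_le_centralRing hG hz),
    eq_sum_primitiveCentralProj hG (LK_le_centralRing hG hw)]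
  exact Finset.sum_congr rfl fun P hP => by rw [h P (by simpa using hP)]

end Lattice

/-! ### Discreteness in the weak operator and norm topologies. -/

section Discrete

attribute [local instance] commRingZNG ringZNG addCommGroupZNG addGroupZNG semigroupZNG
  semiringZNG moduleZNG

/-- Distinct integers are at distance at least `1`, so the finite intersection of unit-ball
preimages around `y` is an open set meeting `S` only in `y`. -/
lemma isDiscrete_of_integral {X ι : Type*} [TopologicalSpace X] [Finite ι] {S : Set X}
    (f : ι → X → ℂ) (hf : ∀ i, Continuous (f i))
    (hinj : ∀ x ∈ S, ∀ y ∈ S, (∀ i, f i x = f i y) → x = y)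
    (hint : ∀ x ∈ S, ∀ i, ∃ m : ℤ, f i x = m) : IsDiscrete S := by
  refine isDiscrete_iff_forall_mem_exists_isOpen.2 fun y hy => ?_
  refine ⟨⋂ i, {x | ‖f i x - f i y‖ < 1}, isOpen_iInter_of_finite fun i =>
    isOpen_lt ((hf i).sub continuous_const).norm continuous_const, ?_⟩
  ext x
  simp only [Set.mem_inter_iff, Set.mem_iInter, Set.mem_singleton_iff]
  constructor
  · rintro ⟨hx, hxS⟩
    refine hinj x hxS y hy fun i => ?_
    obtain ⟨m, hm⟩ := hint x hxS i
    obtain ⟨n, hn⟩ := hint y hy i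
    have h1 : ‖f i x - f i y‖ < 1 := hx i
    rw [hm, hn, ← Int.cast_sub, Complex.norm_intCast] at h1
    have h2 : |m - n| < 1 := by exact_mod_cast h1
    rw [hm, hn, sub_eq_zero.1 (Int.abs_lt_one_iff.1 h2)]
  · rintro rfl
    exact ⟨fun i => by simp, hy⟩

variable {G : Type*} [Group G] {K : Subring ℂ}

lemma continuous_trMul (P : ZNG G) : Continuous (trMul G P) := by
  have h : Continuous fun z : ZNG G => ((z : NG G) : Op G) :=
    continuous_subtype_val.comp continuous_subtype_val
  exact (ContinuousLinearMapWOT.continuous_iff.1 h) _ _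

lemma isDiscrete_LK (hG : lcmG G < ⊤) : IsDiscrete (LK G K : Set (ZNG G)) := by
  have hd : ((lcmG G).toNat : ℂ) ≠ 0 := Nat.cast_ne_zero.2 (lcmG_toNat_spec G hG).1.ne'
  have : Finite (primitiveCentralProj G) := finite_primitiveCentralProj hG
  refine isDiscrete_of_integral
    (fun (P : primitiveCentralProj G) z => ((lcmG G).toNat : ℂ) * trMul G P z)
    (fun P => continuous_const.mul (continuous_trMul _)) (fun z hz w hw h => ?_)
    (fun z hz P => trMul_integral hG hz P.2)
  exact LK_ext hG hz hw fun P hP => mul_left_cancel₀ hd (h ⟨P, hP⟩)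

lemma isDiscrete_norm_LK (hG : lcmG G < ⊤) :
    IsDiscrete ((fun z : ZNG G => ((z : NG G) : Op G).toCLM) '' (LK G K : Set (ZNG G))) := by
  have hd : ((lcmG G).toNat : ℂ) ≠ 0 := Nat.cast_ne_zero.2 (lcmG_toNat_spec G hG).1.ne'
  have : Finite (primitiveCentralProj G) := finite_primitiveCentralProj hG
  refine isDiscrete_of_integral
    -- These functionals extend `lcm(G) · trMul G P` from the center to all bounded operators, where
    -- norm continuity is evident.
    (fun (P : primitiveCentralProj G) (T : L2 G →L[ℂ] L2 G) => ((lcmG G).toNat : ℂ) *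
      ⟪deltaOne G, T ((((P : ZNG G) : NG G) : Op G) (deltaOne G))⟫_ℂ)
    (fun P => by fun_prop) ?_ ?_
  · rintro _ ⟨z, hz, rfl⟩ _ ⟨w, hw, rfl⟩ h
    rw [LK_ext hG hz hw fun P hP => mul_left_cancel₀ hd (h ⟨P, hP⟩)]
  · rintro _ ⟨z, hz, rfl⟩ P
    exact trMul_integral hG hz P.2

end Discrete

end GroupVN

open GroupVN
theorem mainTheorem7 (G : Type*) [Group G] (K : Subring ℂ)
    (hK : ∀ z ∈ fracField K, (starRingEnd ℂ) z ∈ fracField K) (hG : lcmG G < ⊤) :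
    -- `L_K(G)` is discrete in the weak operator topology of `Z(N(G))`
    DiscreteTopology (LK G K) ∧
    -- `L_K(G)` is discrete in the norm topology
    IsDiscrete ((fun z : ZNG G => ((z : NG G) : Op G).toCLM) '' (LK G K : Set (ZNG G))) ∧
    -- the primitive central projections `P^i` are finitely many and pairwise orthogonal
    (primitiveCentralProj G).Finite ∧
    (∀ P ∈ primitiveCentralProj G, ∀ Q ∈ primitiveCentralProj G, P ≠ Q → P * Q = 0) ∧
    -- `L_K(G)` consists of sums of integer multiples of `(lcm(G) tr_G(P^i))⁻¹ P^i`
    LK G K ≤ AddSubgroup.closure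
      ((fun P : ZNG G => (((lcmG G).toNat : ℂ) * trG G (P : NG G))⁻¹ • P) ''
        primitiveCentralProj G) ∧
    -- under the center-valued Atiyah conjecture, the values `dim^u(ker A)` form a discrete set
    (CenterValuedAtiyah G K →
      IsDiscrete {d : ZNG G | ∃ (n : ℕ) (A : Matrix (Fin n) (Fin n) (MonoidAlgebra ℂ G)),
        (∀ i j g, (A i j).coeff g ∈ K) ∧ d = kerDim A}) := by
  refine ⟨isDiscrete_iff_discreteTopology.1 (isDiscrete_LK hG), isDiscrete_norm_LK hG,
    finite_primitiveCentralProj hG,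
    fun P hP Q hQ hPQ => primitiveCentralProj_orthogonal hP hQ hPQ, LK_le_closure hG,
    fun hA => (isDiscrete_LK (K := K) hG).mono ?_⟩
  rintro _ ⟨n, A, hAK, rfl⟩
  exact hA n A hAK
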